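/- Let $G$ be a finite simple plane graph (drawn in the plane with vertices as distinct points and edges as simple arcs that meet only in common ends) with an even number of vertices, in which every edge $e$ carries a weight $\omega_e$ from a commutative ring (for instance a real number). For a subgraph $H$ of $G$ let $M(H)$ be the sum, over all perfect matchings $P$ of $H$, of $\prod_{e\in P}\omega_e$. Write $G-v-w$ for the graph obtained from $G$ by deleting the vertices $v,w$ and all edges incident with them, and $G-e$, $G-e-e'$ for the graphs obtained by deleting only the indicated edges and no vertex. Let $e_1=a_1b_1$ and $e_2=a_2b_2$ be two independent edges of $G$ (that is, the four vertices $a_1,b_1,a_2,b_2$ are distinct) on the boundary of a face $f$ of $G$, and suppose that $a_1,b_1,a_2,b_2$ appear in this cyclic order on a face $g$ of $G$ (for instance $g=f$); that is, there is a closed topological disc which is contained in $g\cup\{a_1,b_1,a_2,b_2\}$ and whose boundary circle passes through $a_1,b_1,a_2,b_2$ in this cyclic order. Then $$M(G)\,M(G-e_1-e_2)+\omega_{e_1}\omega_{e_2}\,M(G-a_1-a_2)\,M(G-b_1-b_2)$$ $$=M(G-e_1)\,M(G-e_2)+\omega_{e_1}\omega_{e_2}\,M(G-a_1-b_2)\,M(G-a_2-b_1).$$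 -/

import Mathlib

/-- A drawing of the graph `G` in the plane (the Euclidean plane is taken as `ℂ`), that is, the
structure that makes `G` a plane graph: distinct vertices are distinct points, every edge is a
simple arc joining its two ends, the interior of an edge contains no vertex, and two different
edges have no common point except common ends. -/
structure PlaneDrawing {V : Type*} (G : SimpleGraph V) where
  /-- The point that represents a vertex. -/
  point : V → ℂ
  point_injective : Function.Injective point
  /-- The arc that represents the edge `uv`, traversed from `u` to `v`. -/
  arc : ∀ {u v : V}, G.Adj u v → Path (point u) (point v)
  arc_symm : ∀ {u v : V} (h : G.Adj u v), arc h.symm = (arc h).symm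
  arc_injective : ∀ {u v : V} (h : G.Adj u v), Function.Injective (arc h)
  eq_or_eq_of_arc_eq_point : ∀ {u v w : V} (h : G.Adj u v) (t : unitInterval),
    arc h t = point w → w = u ∨ w = v
  exists_point_of_arc_eq_arc : ∀ {u v x y : V} (h : G.Adj u v) (h' : G.Adj x y)
    (s t : unitInterval), s(u, v) ≠ s(x, y) → arc h s = arc h' t → ∃ w, arc h s = point w

namespace PlaneDrawing

variable {V : Type*} {G : SimpleGraph V} (D : PlaneDrawing G)

/-- The set of all points of the plane that lie on the drawing. -/
def carrier : Set ℂ :=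
  Set.range D.point ∪ {z | ∃ (u v : V) (h : G.Adj u v), z ∈ Set.range (D.arc h)}

/-- The faces are the connected components of the complement of the drawing. -/
def IsFace (F : Set ℂ) : Prop :=
  ∃ z ∈ D.carrierᶜ, F = connectedComponentIn D.carrierᶜ z

/-- The edge `uv` lies on the boundary of `F`. -/
def EdgeOnBoundary (F : Set ℂ) {u v : V} (h : G.Adj u v) : Prop :=
  Set.range (D.arc h) ⊆ frontier F

/-- The vertices `v 0, v 1, …, v (n - 1)` appear in this cyclic order (clockwise or
counterclockwise) on the face `F`: there is a closed topological disc, the image of the closed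
unit disc under `φ`, whose boundary circle passes through these vertices in this order and which,
apart from these vertices, lies in `F`. When the boundary of `F` is connected, this says that the
vertices occur in this cyclic order along the closed walk that bounds `F`. -/
def InCyclicOrderOn (F : Set ℂ) {n : ℕ} (v : Fin n → V) : Prop :=
  ∃ (φ : ℂ → ℂ) (θ : Fin n → ℝ),
    ContinuousOn φ (Metric.closedBall 0 1) ∧
    Set.InjOn φ (Metric.closedBall 0 1) ∧
    StrictMono θ ∧ (∀ i, θ i ∈ Set.Ico 0 (2 * Real.pi)) ∧
    (∀ i, φ (Complex.exp (θ i * Complex.I)) = D.point (v i)) ∧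
    ∀ z ∈ Metric.closedBall (0 : ℂ) 1, (∀ i, z ≠ Complex.exp (θ i * Complex.I)) → φ z ∈ F

end PlaneDrawing

/-- `P` is a perfect matching of `H`, where `H` and `P` are subgraphs of the same graph. -/
def IsPerfectMatchingOf {V : Type*} {G : SimpleGraph V} (H P : G.Subgraph) : Prop :=
  P ≤ H ∧ P.IsMatching ∧ P.verts = H.verts

open Classical in
/-- The sum `M(H)` of the weights of the perfect matchings of a subgraph `H` of `G`, the weight of
a perfect matching being the product of the weights of its edges. Only the values of `ω` at edges
of `H` matter. -/
noncomputable def matchingSum {V R : Type*} [Fintype V] [CommRing R] {G : SimpleGraph V}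
    (ω : Sym2 V → R) (H : G.Subgraph) : R :=
  ∑ P : G.Subgraph with IsPerfectMatchingOf H P, ∏ e ∈ P.edgeSet.toFinset, ω e

/-! Let `E` be the edge set without $e_1,e_2$. Splitting $M(G)$, $M(G-e_1)$ and $M(G-e_2)$ by the
use of $e_1$ and $e_2$, everything cancels except $\omega_{e_1}\omega_{e_2}$ times Kuo's
condensation identity for the edges `E` at $a_1,b_1,a_2,b_2$ (`edgeMatchingSum_condensation`).

For condensation, superpose two matchings that each miss some of $a,b,c,d$, every one of these four
being covered exactly once. Counting edges, each component contains none or two of the four. If $a$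
were joined to $c$, then $b$ would be joined to $d$ in another component, which planarity forbids.
So $a$ is joined to exactly one of $b,d$, and exchanging the matchings outside the component of $a$
is a weight-preserving involution between the pairs counted on the two sides.

The planarity input is `false_of_crossing_paths`, proved by counting turns with continuous
logarithms. Close two disjoint outer arcs by the images of the crossing chords $p,q$ of the disc.
The torus of pairs of points on the two closed curves splits into four rectangles. On three of them
the difference of the points never vanishes, so its logarithm has no net change around the fourth
either (`logChange_sub_square_eq_zero`). But around the chord rectangle, $\varphi(p)-\varphi(q)$
deforms to the odd map $\varphi(z/2)-\varphi(-z/2)$ along a loop once around $0$, and an odd map has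
nonzero winding (`logChange_chords_ne_zero`). -/

/-! ### Continuous logarithms and their change along curves -/

theorem Complex.eqOn_sub_of_exp_eqOn {X : Type*} [TopologicalSpace X] {S : Set X}
    (hS : IsPreconnected S) {f g : X → ℂ} (hf : ContinuousOn f S) (hg : ContinuousOn g S)
    (h : ∀ x ∈ S, Complex.exp (f x) = Complex.exp (g x)) {a b : X} (ha : a ∈ S) (hb : b ∈ S) :
    f a - f b = g a - g b := by
  -- Both sides lift the same map through the covering `exp`; the shift of `g` makes them agree at
  -- `b`.
  have key := Complex.isCoveringMap_exp.eqOn_of_comp_eqOn (s := S) hS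
    (g₁ := f) (g₂ := fun x ↦ g x + (f b - g b)) hf (by fun_prop) (fun x hx ↦ by
      apply Subtype.ext
      simp only [Function.comp, Complex.exp_add, Complex.exp_sub, h x hx, h b hb,
        div_self (Complex.exp_ne_zero _), mul_one]) hb (by ring)
  have := key ha
  simp only at this
  rw [this]; ring

theorem Complex.exists_continuous_log {E : Type*} [NormedAddCommGroup E] [NormedSpace ℝ E]
    {f : E → ℂ} (hf : Continuous f) (h0 : ∀ x, f x ≠ 0) :
    ∃ L : E → ℂ, Continuous L ∧ ∀ x, Complex.exp (L x) = f x := by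
  obtain ⟨L, ⟨-, hL⟩, -⟩ := Complex.isCoveringMapOn_exp.existsUnique_continuousMap_lifts
    (A := E) ⟨f, hf⟩ (Complex.exp_log (h0 0)) (fun x ↦ h0 x)
  exact ⟨L, L.continuous, fun x ↦ congrFun hL x⟩

/-- Clamping the coordinates extends `F` to a zero-free map on the whole plane, where a lift exists.
-/
theorem Complex.exists_continuous_log_of_unitSquare {F : ℝ × ℝ → ℂ}
    (hF : ContinuousOn F (Set.Icc 0 1 ×ˢ Set.Icc 0 1))
    (h0 : ∀ x ∈ Set.Icc (0 : ℝ) 1 ×ˢ Set.Icc (0 : ℝ) 1, F x ≠ 0) :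
    ∃ L : ℝ × ℝ → ℂ, Continuous L ∧
      ∀ x ∈ Set.Icc (0 : ℝ) 1 ×ˢ Set.Icc (0 : ℝ) 1, Complex.exp (L x) = F x := by
  let c : ℝ × ℝ → ℝ × ℝ := fun x ↦
    ((Set.projIcc (0 : ℝ) 1 zero_le_one x.1 : ℝ), (Set.projIcc (0 : ℝ) 1 zero_le_one x.2 : ℝ))
  have hc : Continuous c := by
    refine .prodMk ?_ ?_
    · exact continuous_subtype_val.comp (continuous_projIcc.comp continuous_fst)
    · exact continuous_subtype_val.comp (continuous_projIcc.comp continuous_snd)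
  have hm : ∀ x, c x ∈ Set.Icc (0 : ℝ) 1 ×ˢ Set.Icc (0 : ℝ) 1 :=
    fun x ↦ ⟨Subtype.coe_prop _, Subtype.coe_prop _⟩
  obtain ⟨L, hL, h⟩ := Complex.exists_continuous_log (f := F ∘ c)
    (hF.comp_continuous hc hm) (fun x ↦ h0 _ (hm x))
  refine ⟨L, hL, fun x hx ↦ ?_⟩
  rw [h]
  simp [c, Set.projIcc_of_mem zero_le_one hx.1, Set.projIcc_of_mem zero_le_one hx.2]

/-- `Δ` is the total change, along the curve `f` on the unit interval, of a continuous
logarithm of `f`. -/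
def HasLogChange (f : ℝ → ℂ) (Δ : ℂ) : Prop :=
  ∃ L : ℝ → ℂ, ContinuousOn L (Set.Icc 0 1) ∧
    (∀ t ∈ Set.Icc (0 : ℝ) 1, Complex.exp (L t) = f t) ∧ L 1 - L 0 = Δ

open Classical in
/-- The total change of a continuous logarithm of `f` along the unit interval. -/
noncomputable def logChange (f : ℝ → ℂ) : ℂ :=
  if h : ∃ Δ, HasLogChange f Δ then h.choose else 0

theorem HasLogChange.unique {f : ℝ → ℂ} {Δ Δ' : ℂ} (h : HasLogChange f Δ)
    (h' : HasLogChange f Δ') : Δ = Δ' := by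
  obtain ⟨L, hL, hf, rfl⟩ := h
  obtain ⟨L', hL', hf', rfl⟩ := h'
  exact Complex.eqOn_sub_of_exp_eqOn isPreconnected_Icc hL hL'
    (fun x hx ↦ (hf x hx).trans (hf' x hx).symm) (by simp) (by simp)

theorem HasLogChange.logChange_eq {f : ℝ → ℂ} {Δ : ℂ} (h : HasLogChange f Δ) :
    logChange f = Δ := by
  have h' : ∃ Δ, HasLogChange f Δ := ⟨Δ, h⟩
  rw [logChange, dif_pos h']
  exact h'.choose_spec.unique h

/-- One logarithm serves the whole square, so both ways from corner $(0,0)$ to $(1,1)$ give the same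
change. -/
theorem logChange_rectangle {F : ℝ → ℝ → ℂ}
    (hF : ContinuousOn (Function.uncurry F) (Set.Icc 0 1 ×ˢ Set.Icc 0 1))
    (h0 : ∀ s ∈ Set.Icc (0 : ℝ) 1, ∀ t ∈ Set.Icc (0 : ℝ) 1, F s t ≠ 0) :
    logChange (fun s ↦ F s 0) + logChange (F 1) =
      logChange (F 0) + logChange (fun s ↦ F s 1) := by
  obtain ⟨L, hL, h⟩ := Complex.exists_continuous_log_of_unitSquare hF
    (fun x hx ↦ h0 x.1 hx.1 x.2 hx.2)
  have row : ∀ t ∈ Set.Icc (0 : ℝ) 1,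
      logChange (fun s ↦ F s t) = L (1, t) - L (0, t) := fun t ht ↦
    HasLogChange.logChange_eq ⟨fun s ↦ L (s, t), by fun_prop, fun s hs ↦ h (s, t) ⟨hs, ht⟩, rfl⟩
  have col : ∀ s ∈ Set.Icc (0 : ℝ) 1,
      logChange (F s) = L (s, 1) - L (s, 0) := fun s hs ↦
    HasLogChange.logChange_eq ⟨fun t ↦ L (s, t), by fun_prop, fun t ht ↦ h (s, t) ⟨hs, ht⟩, rfl⟩
  rw [row 0 (by simp), row 1 (by simp), col 0 (by simp), col 1 (by simp)]
  ring

/-- If the closed curves formed by `p, γ` and by `q, δ` have no common point except on `p` and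
`q`, then the change of the logarithm of `p s - q t` around the unit square is zero. -/
theorem logChange_sub_square_eq_zero {p q γ δ : ℝ → ℂ}
    (hp : ContinuousOn p (Set.Icc 0 1)) (hq : ContinuousOn q (Set.Icc 0 1))
    (hγ : ContinuousOn γ (Set.Icc 0 1)) (hδ : ContinuousOn δ (Set.Icc 0 1))
    (hγ0 : γ 0 = p 1) (hγ1 : γ 1 = p 0) (hδ0 : δ 0 = q 1) (hδ1 : δ 1 = q 0)
    (hγq : ∀ s ∈ Set.Icc (0 : ℝ) 1, ∀ t ∈ Set.Icc (0 : ℝ) 1, γ s ≠ q t)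
    (hγδ : ∀ s ∈ Set.Icc (0 : ℝ) 1, ∀ t ∈ Set.Icc (0 : ℝ) 1, γ s ≠ δ t)
    (hpδ : ∀ s ∈ Set.Icc (0 : ℝ) 1, ∀ t ∈ Set.Icc (0 : ℝ) 1, p s ≠ δ t) :
    logChange (fun s ↦ p s - q 0) + logChange (fun t ↦ p 1 - q t) -
      logChange (fun t ↦ p 0 - q t) - logChange (fun s ↦ p s - q 1) = 0 := by
  have key : ∀ {f g : ℝ → ℂ}, ContinuousOn f (Set.Icc 0 1) → ContinuousOn g (Set.Icc 0 1) →
      (∀ s ∈ Set.Icc (0 : ℝ) 1, ∀ t ∈ Set.Icc (0 : ℝ) 1, f s ≠ g t) →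
      logChange (fun s ↦ f s - g 0) + logChange (fun t ↦ f 1 - g t) =
        logChange (fun t ↦ f 0 - g t) + logChange (fun s ↦ f s - g 1) := by
    intro f g hf hg h
    refine logChange_rectangle (F := fun s t ↦ f s - g t) ?_
      (fun s hs t ht ↦ sub_ne_zero.2 (h s hs t ht))
    exact (hf.comp continuousOn_fst fun x hx ↦ hx.1).sub
      (hg.comp continuousOn_snd fun x hx ↦ hx.2)
  -- These are the three zero-free rectangles of the torus; sides shared with the fourth or with
  -- each other cancel.
  have e1 := key hγ hq hγq
  have e2 := key hγ hδ hγδ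
  have e3 := key hp hδ hpδ
  rw [hγ0, hγ1] at e1 e2
  rw [hδ0, hδ1] at e2 e3
  linear_combination -e1 - e2 - e3

/-! ### Interlaced arcs outside an embedded disc -/

section Crossing

variable {φ : ℂ → ℂ}

/-- The change of logarithm along the deformation of `φ u - φ v` into `φ z - φ (-z)` with
`z = (u - v) / 2`. -/
noncomputable def symmetrizeLogChange (φ : ℂ → ℂ) (u v : ℂ) : ℂ :=
  logChange fun τ ↦ φ (u - τ * ((u + v) / 2)) - φ (v - τ * ((u + v) / 2))

theorem sub_mul_mid_mem_closedBall {u v : ℂ} (hu : u ∈ Metric.closedBall (0 : ℂ) 1)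
    (hv : v ∈ Metric.closedBall (0 : ℂ) 1) {τ : ℝ} (hτ : τ ∈ Set.Icc (0 : ℝ) 1) :
    u - τ * ((u + v) / 2) ∈ Metric.closedBall (0 : ℂ) 1 := by
  have hv' : -v ∈ Metric.closedBall (0 : ℂ) 1 := by simpa using hv
  have := convex_closedBall (0 : ℂ) 1 hu hv' (show 0 ≤ 1 - τ / 2 by linarith [hτ.2])
    (show 0 ≤ τ / 2 by linarith [hτ.1]) (by ring)
  convert this using 1
  simp only [Complex.real_smul]
  push_cast
  ring

/-- Subtracting the same multiple of the midpoint from both points keeps them distinct and inside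
the disc, and ends at an antipodal pair. The correction terms depend only on the endpoints, so they
cancel around a closed loop. -/
theorem logChange_comp_sub_comp (hφ : ContinuousOn φ (Metric.closedBall 0 1))
    (hinj : Set.InjOn φ (Metric.closedBall 0 1)) {x y : ℝ → ℂ} (hx : Continuous x)
    (hy : Continuous y) (hxm : ∀ t ∈ Set.Icc (0 : ℝ) 1, x t ∈ Metric.closedBall (0 : ℂ) 1)
    (hym : ∀ t ∈ Set.Icc (0 : ℝ) 1, y t ∈ Metric.closedBall (0 : ℂ) 1)
    (hxy : ∀ t ∈ Set.Icc (0 : ℝ) 1, x t ≠ y t) :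
    logChange (fun t ↦ φ (x t) - φ (y t)) =
      logChange (fun t ↦ φ ((x t - y t) / 2) - φ (-((x t - y t) / 2))) +
        symmetrizeLogChange φ (x 0) (y 0) - symmetrizeLogChange φ (x 1) (y 1) := by
  have key := logChange_rectangle
    (F := fun τ t ↦ φ (x t - τ * ((x t + y t) / 2)) - φ (y t - τ * ((x t + y t) / 2))) ?_ ?_
  · have e1 : ∀ t, x t - (1 : ℝ) * ((x t + y t) / 2) = (x t - y t) / 2 := fun t ↦ by
      push_cast; ring
    have e2 : ∀ t, y t - (1 : ℝ) * ((x t + y t) / 2) = -((x t - y t) / 2) := fun t ↦ by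
      push_cast; ring
    have e3 : ∀ u v : ℂ, u - (0 : ℝ) * v = u := fun u v ↦ by simp
    simp only [e1, e2, e3] at key
    rw [symmetrizeLogChange, symmetrizeLogChange]
    linear_combination -key
  · refine ContinuousOn.sub (hφ.comp (by fun_prop) fun z hz ↦ ?_)
      (hφ.comp (by fun_prop) fun z hz ↦ ?_)
    · exact sub_mul_mid_mem_closedBall (hxm _ hz.2) (hym _ hz.2) hz.1
    · rw [add_comm (x z.2)]
      exact sub_mul_mid_mem_closedBall (hym _ hz.2) (hxm _ hz.2) hz.1
  · intro τ hτ t ht h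
    have h1 := sub_mul_mid_mem_closedBall (hxm _ ht) (hym _ ht) hτ
    have h2 := sub_mul_mid_mem_closedBall (hym _ ht) (hxm _ ht) hτ
    rw [add_comm (y t)] at h2
    exact hxy t ht (sub_left_injective (hinj h1 h2 (sub_eq_zero.1 h)))

/-- The odd map `z ↦ φ (z / 2) - φ (-z / 2)`, pulled back along the exponential map, has a
logarithm which changes by a nonzero amount over a period. -/
theorem exists_log_symmetrize (hφ : ContinuousOn φ (Metric.closedBall 0 1))
    (hinj : Set.InjOn φ (Metric.closedBall 0 1)) :
    ∃ Λ : ℂ → ℂ, Continuous Λ ∧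
      (∀ w : ℂ, ‖Complex.exp w‖ ≤ 2 →
        Complex.exp (Λ w) = φ (Complex.exp w / 2) - φ (-(Complex.exp w / 2))) ∧
      ∀ w : ℂ, Λ (w + 2 * Real.pi * Complex.I) - Λ w ≠ 0 := by
  -- Capping the modulus at 2 keeps `c w` in the disc for every `w`, without changing it where `‖exp
  -- w‖ ≤ 2`.
  let c : ℂ → ℂ := fun w ↦ Complex.exp ((min w.re (Real.log 2) : ℝ) + w.im * Complex.I) / 2
  have hc : Continuous c := by fun_prop
  have hcm : ∀ w, c w ∈ Metric.closedBall (0 : ℂ) 1 := by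
    intro w
    have : Real.exp (min w.re (Real.log 2)) ≤ 2 := by
      calc _ ≤ Real.exp (Real.log 2) := Real.exp_le_exp.2 (min_le_right _ _)
        _ = 2 := Real.exp_log two_pos
    simp only [mem_closedBall_zero_iff, c, norm_div, Complex.norm_exp]
    simp
    linarith
  have hcm' : ∀ w, -c w ∈ Metric.closedBall (0 : ℂ) 1 := fun w ↦ by simpa using hcm w
  have hc0 : ∀ w, c w ≠ 0 := fun w ↦ by simp [c, Complex.exp_ne_zero]
  obtain ⟨Λ, hΛ, h⟩ := Complex.exists_continuous_log (f := fun w ↦ φ (c w) - φ (-c w))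
    ((hφ.comp_continuous hc hcm).sub (hφ.comp_continuous hc.neg hcm')) (fun w hw ↦ by
      have := hinj (hcm w) (hcm' w) (sub_eq_zero.1 hw)
      exact hc0 w (self_eq_neg.1 this))
  refine ⟨Λ, hΛ, fun w hw ↦ ?_, fun w hw ↦ ?_⟩
  · rw [h]
    have : w.re ≤ Real.log 2 := by
      rw [Complex.norm_exp] at hw
      rwa [Real.le_log_iff_exp_le two_pos]
    simp [c, min_eq_left this, Complex.re_add_im]
  · have hcπ : ∀ w, c (w + Real.pi * Complex.I) = - c w := by
      intro w
      simp only [c]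
      have : ((min (w + Real.pi * Complex.I).re (Real.log 2) : ℝ) : ℂ) +
          (w + Real.pi * Complex.I).im * Complex.I =
          ((min w.re (Real.log 2) : ℝ) + w.im * Complex.I) + Real.pi * Complex.I := by
        simp
        ring
      rw [this, Complex.exp_add, Complex.exp_pi_mul_I]
      ring
    have hg : ∀ w, Complex.exp (Λ (w + Real.pi * Complex.I) - Λ w) = -1 := by
      intro w
      have h1 := h w
      have h0 := Complex.exp_ne_zero (Λ w)
      rw [Complex.exp_sub, h, hcπ, neg_neg, div_eq_iff h0, h1]
      ring
    -- The half-period increment of `Λ` is a continuous logarithm of $-1$, hence constant. The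
    -- full-period increment is twice it, so if that vanished, $-1$ would be `exp 0`.
    have := Complex.eqOn_sub_of_exp_eqOn (S := Set.univ) isPreconnected_univ
      (f := fun w ↦ Λ (w + Real.pi * Complex.I) - Λ w) (g := fun _ ↦ Real.pi * Complex.I)
      (by fun_prop) (by fun_prop) (fun x _ ↦ by rw [hg, Complex.exp_pi_mul_I])
      (Set.mem_univ (w + Real.pi * Complex.I)) (Set.mem_univ w)
    simp only [sub_self] at this
    have e : w + Real.pi * Complex.I + Real.pi * Complex.I = w + 2 * Real.pi * Complex.I := by
      ring
    rw [e] at this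
    have h3 : Λ (w + Real.pi * Complex.I) - Λ w = 0 := by
      linear_combination (1 / 2 : ℂ) * hw - (1 / 2 : ℂ) * this
    have := hg w
    rw [h3, Complex.exp_zero] at this
    norm_num at this

/-- Each argument lies in $(0,\pi)$, so their sum is a multiple of $2\pi$ strictly between $0$ and
$4\pi$. -/
theorem Complex.sum_log_of_mul_eq_one {r₁ r₂ r₃ r₄ : ℂ} (h₁ : 0 < r₁.im) (h₂ : 0 < r₂.im)
    (h₃ : 0 < r₃.im) (h₄ : 0 < r₄.im) (h : r₁ * r₂ * r₃ * r₄ = 1) :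
    Complex.log r₁ + Complex.log r₂ + Complex.log r₃ + Complex.log r₄ =
      2 * Real.pi * Complex.I := by
  have key : ∀ r : ℂ, 0 < r.im → 0 < (Complex.log r).im ∧ (Complex.log r).im < Real.pi ∧ r ≠ 0 := by
    intro r hr
    have h0 : r ≠ 0 := by rintro rfl; simp at hr
    refine ⟨?_, ?_, h0⟩
    · rw [Complex.log_im]
      refine lt_of_le_of_ne (Complex.arg_nonneg_iff.2 hr.le) fun h ↦ ?_
      rw [eq_comm, Complex.arg_eq_zero_iff] at h
      exact hr.ne' h.2
    · rw [Complex.log_im]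
      refine Complex.arg_lt_pi_iff.2 (Or.inr hr.ne')
  obtain ⟨a1, b1, c1⟩ := key _ h₁
  obtain ⟨a2, b2, c2⟩ := key _ h₂
  obtain ⟨a3, b3, c3⟩ := key _ h₃
  obtain ⟨a4, b4, c4⟩ := key _ h₄
  have he : Complex.exp (Complex.log r₁ + Complex.log r₂ + Complex.log r₃ + Complex.log r₄) = 1 := by
    simp only [Complex.exp_add, Complex.exp_log c1, Complex.exp_log c2, Complex.exp_log c3,
      Complex.exp_log c4, h]
  obtain ⟨n, hn⟩ := Complex.exp_eq_one_iff.1 he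
  have him := congrArg Complex.im hn
  simp only [Complex.add_im] at him
  have e : ((n : ℂ) * (2 * Real.pi * Complex.I)).im = n * (2 * Real.pi) := by simp
  rw [e] at him
  have hπ := Real.pi_pos
  have hn1 : (0 : ℝ) < n := by
    by_contra hcon
    nlinarith
  have hn2 : (n : ℝ) < 2 := by
    by_contra hcon
    nlinarith
  have : n = 1 := by
    have h1 : 0 < n := by exact_mod_cast hn1
    have h2 : n < 2 := by exact_mod_cast hn2
    omega
  rw [hn, this]
  simp

/-- Divided by `z₀`, the segment stays in the slit plane because `z₁ / z₀` is not real, so the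
principal logarithm follows it. -/
theorem logChange_segment {ψ Λ : ℂ → ℂ} (hΛ : Continuous Λ)
    (hψ : ∀ w : ℂ, ‖Complex.exp w‖ ≤ 2 → Complex.exp (Λ w) = ψ (Complex.exp w))
    {z₀ z₁ w : ℂ} (hz₀ : ‖z₀‖ ≤ 2) (hz₁ : ‖z₁‖ ≤ 2) (hw : Complex.exp w = z₀)
    (him : (z₁ / z₀).im ≠ 0) {z : ℝ → ℂ} (hz : ∀ t, z t = (1 - t) * z₀ + t * z₁) :
    logChange (fun t ↦ ψ (z t)) = Λ (w + Complex.log (z₁ / z₀)) - Λ w := by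
  have h0 : z₀ ≠ 0 := hw ▸ Complex.exp_ne_zero w
  have hslit : ∀ t : ℝ, (1 - t) + t * (z₁ / z₀) ∈ Complex.slitPlane := by
    intro t
    rw [Complex.mem_slitPlane_iff]
    rcases eq_or_ne t 0 with rfl | ht
    · simp
    · right
      have : ((1 : ℂ) - t + t * (z₁ / z₀)).im = t * (z₁ / z₀).im := by
        simp only [Complex.add_im, Complex.sub_im, Complex.one_im, Complex.ofReal_im,
          Complex.im_ofReal_mul]
        ring
      rw [this]
      exact mul_ne_zero ht him
  refine HasLogChange.logChange_eq
    ⟨fun t ↦ Λ (w + Complex.log ((1 - t) + t * (z₁ / z₀))), ?_, fun t ht ↦ ?_, by simp⟩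
  · refine Continuous.continuousOn (hΛ.comp (continuous_const.add ?_))
    exact Continuous.clog (by fun_prop) hslit
  · have e : Complex.exp (w + Complex.log ((1 - t) + t * (z₁ / z₀))) = z t := by
      rw [Complex.exp_add, hw, Complex.exp_log (Complex.slitPlane_ne_zero (hslit t)), hz]
      field_simp
    rw [hψ _ _, e]
    rw [e, hz]
    calc ‖(1 - t) * z₀ + t * z₁‖ ≤ ‖((1 - t : ℝ) : ℂ) * z₀‖ + ‖(t : ℂ) * z₁‖ := by
          push_cast; exact norm_add_le _ _
      _ = (1 - t) * ‖z₀‖ + t * ‖z₁‖ := by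
          rw [norm_mul, norm_mul, Complex.norm_of_nonneg (by linarith [ht.2]),
            Complex.norm_of_nonneg ht.1]
      _ ≤ 2 := by nlinarith [ht.1, ht.2]

theorem Complex.exp_I_sub_exp_I (a b : ℝ) :
    Complex.exp (a * Complex.I) - Complex.exp (b * Complex.I) =
      (Real.sin ((a - b) / 2) : ℂ) * (2 * Complex.I * Complex.exp ((a + b) / 2 * Complex.I)) := by
  have e1 : (a : ℂ) * Complex.I = (a + b) / 2 * Complex.I + (a - b) / 2 * Complex.I := by ring
  have e2 : (b : ℂ) * Complex.I = (a + b) / 2 * Complex.I + -((a - b) / 2) * Complex.I := by ring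
  rw [e1, e2, Complex.exp_add, Complex.exp_add, Complex.exp_mul_I ((a - b) / 2),
    Complex.exp_mul_I (-((a - b) / 2)), Complex.cos_neg, Complex.sin_neg]
  push_cast
  ring

/-- The angle inscribed at `b` from `c` to `a`. -/
theorem Complex.inscribed_ratio_im (a b c : ℝ) (h : Real.sin ((c - b) / 2) ≠ 0) :
    ((Complex.exp (a * Complex.I) - Complex.exp (b * Complex.I)) /
      (Complex.exp (c * Complex.I) - Complex.exp (b * Complex.I))).im =
    Real.sin ((a - b) / 2) / Real.sin ((c - b) / 2) * Real.sin ((a - c) / 2) := by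
  have h' : (Real.sin ((c - b) / 2) : ℂ) ≠ 0 := by exact_mod_cast h
  have : (Complex.exp (a * Complex.I) - Complex.exp (b * Complex.I)) /
      (Complex.exp (c * Complex.I) - Complex.exp (b * Complex.I)) =
      ((Real.sin ((a - b) / 2) / Real.sin ((c - b) / 2) : ℝ) : ℂ) *
        Complex.exp (((a - c) / 2 : ℝ) * Complex.I) := by
    have e : ((a : ℂ) + b) / 2 * Complex.I =
        (c + b) / 2 * Complex.I + ((a - c) / 2 : ℝ) * Complex.I := by push_cast; ring
    rw [Complex.exp_I_sub_exp_I, Complex.exp_I_sub_exp_I, e, Complex.exp_add,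
      Complex.ofReal_div (Real.sin _) (Real.sin _)]
    have h2 := Complex.exp_ne_zero ((c + b) / 2 * Complex.I)
    have h3 := Complex.I_ne_zero
    field_simp
  rw [this, Complex.im_ofReal_mul, Complex.exp_ofReal_mul_I_im]

/-- After symmetrization only $p(s)-q(t)$ matters. Around the square it traverses the quadrilateral
$C-B,\ A-B,\ A-D,\ C-D$. Each side turns by an inscribed angle in $(0,\pi)$, and together they make
one full turn, over which `Λ` changes by a nonzero amount. -/
theorem logChange_chords_ne_zero (hφ : ContinuousOn φ (Metric.closedBall 0 1))
    (hinj : Set.InjOn φ (Metric.closedBall 0 1)) {a b c d : ℝ} (hab : a < b) (hbc : b < c)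
    (hcd : c < d) (hda : d < a + 2 * Real.pi) {A B C D : ℂ}
    (hA : A = Complex.exp (a * Complex.I)) (hB : B = Complex.exp (b * Complex.I))
    (hC : C = Complex.exp (c * Complex.I)) (hD : D = Complex.exp (d * Complex.I))
    {p q : ℝ → ℂ} (hp : ∀ t, p t = (1 - t) * C + t * A) (hq : ∀ t, q t = (1 - t) * B + t * D) :
    logChange (fun s ↦ φ (p s) - φ (q 0)) + logChange (fun t ↦ φ (p 1) - φ (q t)) -
      logChange (fun t ↦ φ (p 0) - φ (q t)) - logChange (fun s ↦ φ (p s) - φ (q 1)) ≠ 0 := by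
  have pos : ∀ {x y : ℝ}, x < y → y < x + 2 * Real.pi → 0 < Real.sin ((y - x) / 2) :=
    fun h h' ↦ Real.sin_pos_of_pos_of_lt_pi (by linarith) (by linarith)
  have neg : ∀ {x y : ℝ}, x < y → y < x + 2 * Real.pi → Real.sin ((x - y) / 2) < 0 :=
    fun h h' ↦ Real.sin_neg_of_neg_of_neg_pi_lt (by linarith) (by linarith)
  have i1 : 0 < ((A - B) / (C - B)).im := by
    rw [hA, hB, hC, Complex.inscribed_ratio_im _ _ _ (pos hbc (by linarith)).ne']
    exact mul_pos_of_neg_of_neg (div_neg_of_neg_of_pos (neg hab (by linarith))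
      (pos hbc (by linarith))) (neg (hab.trans hbc) (by linarith))
  have i2 : 0 < ((A - D) / (A - B)).im := by
    rw [← neg_div_neg_eq, neg_sub, neg_sub, hA, hB, hD,
      Complex.inscribed_ratio_im _ _ _ (pos hab (by linarith)).ne']
    exact mul_pos (div_pos (pos (by linarith) (by linarith))
      (pos hab (by linarith))) (pos (by linarith) (by linarith))
  have i3 : 0 < ((C - D) / (A - D)).im := by
    rw [hA, hC, hD, Complex.inscribed_ratio_im _ _ _ (neg (by linarith) (by linarith)).ne]
    exact mul_pos (div_pos_of_neg_of_neg (neg (by linarith) (by linarith))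
      (neg (by linarith) (by linarith))) (pos (by linarith) (by linarith))
  have i4 : 0 < ((C - B) / (C - D)).im := by
    rw [← neg_div_neg_eq, neg_sub, neg_sub, hB, hC, hD,
      Complex.inscribed_ratio_im _ _ _ (pos (by linarith) (by linarith)).ne']
    exact mul_pos_of_neg_of_neg (div_neg_of_neg_of_pos (neg (by linarith) (by linarith))
      (pos (by linarith) (by linarith))) (neg (by linarith) (by linarith))
  have ne : ∀ {u v : ℂ}, 0 < (u / v).im → u ≠ 0 ∧ v ≠ 0 := by
    intro u v h
    constructor <;> rintro rfl <;> simp at h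
  obtain ⟨hAD, hAB⟩ := ne i2
  obtain ⟨hCB, hCD⟩ := ne i4
  have inv_im : ∀ {u v : ℂ}, 0 < (u / v).im → (v / u).im ≠ 0 := by
    intro u v h
    rw [← inv_div, Complex.inv_im]
    refine div_ne_zero (neg_ne_zero.2 h.ne') ?_
    rw [Ne, Complex.normSq_eq_zero]
    intro h0; rw [h0] at h; simp at h
  have inv_log : ∀ {u v : ℂ}, 0 < (u / v).im → Complex.log (v / u) = -Complex.log (u / v) := by
    intro u v h
    rw [← inv_div, Complex.log_inv]
    intro h0
    rw [Complex.arg_eq_pi_iff] at h0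
    exact h.ne' h0.2
  have hsum := Complex.sum_log_of_mul_eq_one i1 i2 i3 i4 (by field_simp)
  have nA : ‖A‖ = 1 := by rw [hA, Complex.norm_exp_ofReal_mul_I]
  have nB : ‖B‖ = 1 := by rw [hB, Complex.norm_exp_ofReal_mul_I]
  have nC : ‖C‖ = 1 := by rw [hC, Complex.norm_exp_ofReal_mul_I]
  have nD : ‖D‖ = 1 := by rw [hD, Complex.norm_exp_ofReal_mul_I]
  have n2 : ∀ {u v : ℂ}, ‖u‖ = 1 → ‖v‖ = 1 → ‖u - v‖ ≤ 2 := fun hu hv ↦ by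
    linarith [norm_sub_le _ _ |>.trans_eq (congrArg₂ (· + ·) hu hv)]
  have hmem : ∀ {u v : ℂ}, ‖u‖ = 1 → ‖v‖ = 1 → ∀ t ∈ Set.Icc (0 : ℝ) 1,
      (1 - t) * u + t * v ∈ Metric.closedBall (0 : ℂ) 1 := by
    intro u v hu hv t ht
    have := convex_closedBall (0 : ℂ) 1 (mem_closedBall_zero_iff.2 hu.le)
      (mem_closedBall_zero_iff.2 hv.le) (sub_nonneg.2 ht.2) ht.1 (by ring)
    simpa using this
  have mem : ∀ {u : ℂ}, ‖u‖ = 1 → u ∈ Metric.closedBall (0 : ℂ) 1 :=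
    fun hu ↦ mem_closedBall_zero_iff.2 hu.le
  have cp : Continuous p := by rw [funext hp]; fun_prop
  have cq : Continuous q := by rw [funext hq]; fun_prop
  have p0 : p 0 = C := by simp [hp]
  have p1 : p 1 = A := by simp [hp]
  have q0 : q 0 = B := by simp [hq]
  have q1 : q 1 = D := by simp [hq]
  have pm : ∀ t ∈ Set.Icc (0 : ℝ) 1, p t ∈ Metric.closedBall (0 : ℂ) 1 :=
    fun t ht ↦ by rw [hp]; exact hmem nC nA t ht
  have qm : ∀ t ∈ Set.Icc (0 : ℝ) 1, q t ∈ Metric.closedBall (0 : ℂ) 1 :=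
    fun t ht ↦ by rw [hq]; exact hmem nB nD t ht
  have sne : ∀ {u v : ℂ}, (u / v).im ≠ 0 → ∀ t : ℝ, (1 - t) * v + t * u ≠ 0 := by
    intro u v h t h0
    have hv : v ≠ 0 := by rintro rfl; simp at h
    have e : (1 - t) + t * (u / v) = 0 := by field_simp; linear_combination h0
    have e1 := congrArg Complex.im e
    simp only [Complex.add_im, Complex.sub_im, Complex.one_im, Complex.ofReal_im,
      Complex.im_ofReal_mul, Complex.zero_im] at e1
    have ht : t = 0 := by
      rcases mul_eq_zero.1 (show t * (u / v).im = 0 by linarith) with h1 | h1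
      · exact h1
      · exact absurd h1 h
    rw [ht] at e
    simp at e
  have z1 : ∀ t, p t - B = (1 - t) * (C - B) + t * (A - B) := fun t ↦ by rw [hp]; ring
  have z2 : ∀ t, A - q t = (1 - t) * (A - B) + t * (A - D) := fun t ↦ by rw [hq]; ring
  have z3 : ∀ t, p t - D = (1 - t) * (C - D) + t * (A - D) := fun t ↦ by rw [hp]; ring
  have z4 : ∀ t, C - q t = (1 - t) * (C - B) + t * (C - D) := fun t ↦ by rw [hq]; ring
  have s1 := logChange_comp_sub_comp hφ hinj cp continuous_const pm (fun _ _ ↦ mem nB)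
    (fun t _ ↦ sub_ne_zero.1 (z1 t ▸ sne i1.ne' t))
  have s2 := logChange_comp_sub_comp hφ hinj continuous_const cq (fun _ _ ↦ mem nA) qm
    (fun t _ ↦ sub_ne_zero.1 (z2 t ▸ sne i2.ne' t))
  have s3 := logChange_comp_sub_comp hφ hinj cp continuous_const pm (fun _ _ ↦ mem nD)
    (fun t _ ↦ sub_ne_zero.1 (z3 t ▸ sne (inv_im i3) t))
  have s4 := logChange_comp_sub_comp hφ hinj continuous_const cq (fun _ _ ↦ mem nC) qm
    (fun t _ ↦ sub_ne_zero.1 (z4 t ▸ sne (inv_im i4) t))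
  obtain ⟨Λ, hΛ, hψ, hper⟩ := exists_log_symmetrize hφ hinj
  have t1 := logChange_segment (ψ := fun z ↦ φ (z / 2) - φ (-(z / 2))) hΛ hψ (n2 nC nB) (n2 nA nB)
    (Complex.exp_log hCB) i1.ne' z1
  have t2 := logChange_segment (ψ := fun z ↦ φ (z / 2) - φ (-(z / 2))) hΛ hψ (n2 nA nB) (n2 nA nD)
    (w := Complex.log (C - B) + Complex.log ((A - B) / (C - B)))
    (by rw [Complex.exp_add, Complex.exp_log hCB, Complex.exp_log (div_ne_zero hAB hCB)]
        field_simp) i2.ne' z2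
  have t4 := logChange_segment (ψ := fun z ↦ φ (z / 2) - φ (-(z / 2))) hΛ hψ (n2 nC nB) (n2 nC nD)
    (Complex.exp_log hCB) (inv_im i4) z4
  -- The extra $2\pi i$ makes both routes reach the same logarithm of $A-D$; the mismatch is then a
  -- full period of `Λ` at $C-D$.
  have t3 := logChange_segment (ψ := fun z ↦ φ (z / 2) - φ (-(z / 2))) hΛ hψ (n2 nC nD) (n2 nA nD)
    (w := Complex.log (C - B) - Complex.log ((C - B) / (C - D)) + 2 * Real.pi * Complex.I)
    (by rw [Complex.exp_add, Complex.exp_two_pi_mul_I, Complex.exp_sub, Complex.exp_log hCB,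
          Complex.exp_log (div_ne_zero hCB hCD)]
        field_simp) (inv_im i3) z3
  rw [inv_log i4] at t4
  rw [inv_log i3] at t3
  rw [p0, p1, q0, q1, s1, s2, s3, s4, t1, t2, t3, t4, p0, p1, q0, q1]
  have e1 : Complex.log (C - B) - Complex.log ((C - B) / (C - D)) + 2 * Real.pi * Complex.I +
      -Complex.log ((C - D) / (A - D)) = Complex.log (C - B) + Complex.log ((A - B) / (C - B)) +
      Complex.log ((A - D) / (A - B)) := by
    linear_combination -hsum
  rw [e1, ← sub_eq_add_neg]
  have := hper (Complex.log (C - B) - Complex.log ((C - B) / (C - D)))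
  intro h
  apply this
  linear_combination h

/-- Two disjoint arcs outside an embedded closed disc cannot join two pairs of points of the
boundary circle that separate each other. -/
theorem false_of_crossing_paths (hφ : ContinuousOn φ (Metric.closedBall 0 1))
    (hinj : Set.InjOn φ (Metric.closedBall 0 1)) {a b c d : ℝ} (hab : a < b) (hbc : b < c)
    (hcd : c < d) (hda : d < a + 2 * Real.pi) {A B C D : ℂ}
    (hA : A = Complex.exp (a * Complex.I)) (hB : B = Complex.exp (b * Complex.I))
    (hC : C = Complex.exp (c * Complex.I)) (hD : D = Complex.exp (d * Complex.I))
    {S T : Set ℂ} (hS : JoinedIn S (φ A) (φ C)) (hT : JoinedIn T (φ B) (φ D))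
    (hST : Disjoint S T)
    (hSφ : ∀ z ∈ Metric.closedBall (0 : ℂ) 1, φ z ∈ S → z = A ∨ z = C)
    (hTφ : ∀ z ∈ Metric.closedBall (0 : ℂ) 1, φ z ∈ T → z = B ∨ z = D) : False := by
  have nA : ‖A‖ = 1 := by rw [hA, Complex.norm_exp_ofReal_mul_I]
  have nB : ‖B‖ = 1 := by rw [hB, Complex.norm_exp_ofReal_mul_I]
  have nC : ‖C‖ = 1 := by rw [hC, Complex.norm_exp_ofReal_mul_I]
  have nD : ‖D‖ = 1 := by rw [hD, Complex.norm_exp_ofReal_mul_I]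
  let p : ℝ → ℂ := fun t ↦ (1 - t) * C + t * A
  let q : ℝ → ℂ := fun t ↦ (1 - t) * B + t * D
  have hmem : ∀ {u v : ℂ}, ‖u‖ = 1 → ‖v‖ = 1 → ∀ t ∈ Set.Icc (0 : ℝ) 1,
      (1 - t) * u + t * v ∈ Metric.closedBall (0 : ℂ) 1 := by
    intro u v hu hv t ht
    have := convex_closedBall (0 : ℂ) 1 (mem_closedBall_zero_iff.2 hu.le)
      (mem_closedBall_zero_iff.2 hv.le) (sub_nonneg.2 ht.2) ht.1 (by ring)
    simpa using this
  -- By strict convexity a chord meets the circle only in its ends.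
  have hend : ∀ {u v z : ℂ}, ‖u‖ = 1 → ‖v‖ = 1 → ‖z‖ = 1 → ∀ t ∈ Set.Icc (0 : ℝ) 1,
      (1 - t) * u + t * v = z → z = u ∨ z = v := by
    intro u v z hu hv hz t ht h
    rcases eq_or_ne u v with rfl | huv
    · left; rw [← h]; ring
    rcases ht.1.eq_or_lt with rfl | h0
    · left; rw [← h]; simp
    rcases ht.2.eq_or_lt with rfl | h1
    · right; rw [← h]; simp
    have := combo_mem_ball_of_ne (z := (0 : ℂ)) (r := 1) (mem_closedBall_zero_iff.2 hu.le)
      (mem_closedBall_zero_iff.2 hv.le) huv (sub_pos.2 h1) h0 (by ring)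
    have e : (1 - t) • u + t • v = z := by rw [← h]; simp
    rw [e, mem_ball_zero_iff] at this
    linarith
  have ne : ∀ {x y : ℂ}, φ x ∈ S → φ y ∈ T → x ≠ y := by
    rintro x y hx hy rfl
    exact Set.disjoint_left.1 hST hx hy
  have cp : ContinuousOn (fun t ↦ φ (p t)) (Set.Icc 0 1) :=
    hφ.comp (by fun_prop) fun t ht ↦ hmem nC nA t ht
  have cq : ContinuousOn (fun t ↦ φ (q t)) (Set.Icc 0 1) :=
    hφ.comp (by fun_prop) fun t ht ↦ hmem nB nD t ht
  obtain ⟨γ, hγ⟩ := hS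
  obtain ⟨δ, hδ⟩ := hT.symm
  have mγ : ∀ s, γ.extend s ∈ S := fun s ↦ hγ _
  have mδ : ∀ s, δ.extend s ∈ T := fun s ↦ hδ _
  have sA : φ A ∈ S := γ.source ▸ hγ 0
  have sC : φ C ∈ S := γ.target ▸ hγ 1
  have tB : φ B ∈ T := δ.target ▸ hδ 1
  have tD : φ D ∈ T := δ.source ▸ hδ 0
  refine logChange_chords_ne_zero hφ hinj hab hbc hcd hda hA hB hC hD (p := p) (q := q)
    (fun _ ↦ rfl) (fun _ ↦ rfl) ?_
  refine logChange_sub_square_eq_zero (p := fun t ↦ φ (p t)) (q := fun t ↦ φ (q t))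
    (γ := γ.extend) (δ := δ.extend) cp cq
    γ.continuous_extend.continuousOn δ.continuous_extend.continuousOn (by simp [p]) (by simp [p])
    (by simp [q]) (by simp [q]) ?_ ?_ ?_
  · intro s _ t ht h
    have h1 := hSφ (q t) (hmem nB nD t ht) (h ▸ mγ s)
    have h2 : q t = B ∨ q t = D := by
      rcases h1 with h1 | h1
      · exact h1 ▸ hend nB nD nA t ht h1
      · exact h1 ▸ hend nB nD nC t ht h1
    rcases h1 with h1 | h1 <;> rcases h2 with h2 | h2
    · exact ne sA tB (h1.symm.trans h2)
    · exact ne sA tD (h1.symm.trans h2)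
    · exact ne sC tB (h1.symm.trans h2)
    · exact ne sC tD (h1.symm.trans h2)
  · intro s _ t _ h
    exact Set.disjoint_left.1 hST (mγ s) (h ▸ mδ t)
  · intro t ht s _ h
    have h1 := hTφ (p t) (hmem nC nA t ht) (h ▸ mδ s)
    have h2 : p t = C ∨ p t = A := by
      rcases h1 with h1 | h1
      · exact h1 ▸ hend nC nA nB t ht h1
      · exact h1 ▸ hend nC nA nD t ht h1
    rcases h1 with h1 | h1 <;> rcases h2 with h2 | h2
    · exact ne sC tB (h2.symm.trans h1)
    · exact ne sA tB (h2.symm.trans h1)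
    · exact ne sC tD (h2.symm.trans h1)
    · exact ne sA tD (h2.symm.trans h1)

end Crossing

/-! ### Noncrossing in a plane drawing -/

namespace PlaneDrawing

variable {V : Type*} {G : SimpleGraph V} (D : PlaneDrawing G)

/-- The points of the drawing on the vertices in `C` and the edges between them. -/
def carrierOn (C : Set V) : Set ℂ :=
  D.point '' C ∪ {z | ∃ u ∈ C, ∃ v ∈ C, ∃ h : G.Adj u v, z ∈ Set.range (D.arc h)}

theorem carrierOn_subset (C : Set V) : D.carrierOn C ⊆ D.carrier := by
  rintro z (⟨u, -, rfl⟩ | ⟨u, -, v, -, h, hz⟩)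
  · exact Or.inl ⟨u, rfl⟩
  · exact Or.inr ⟨u, v, h, hz⟩

theorem mem_of_point_mem_carrierOn {C : Set V} {w : V} (h : D.point w ∈ D.carrierOn C) :
    w ∈ C := by
  obtain ⟨u, hu, e⟩ | ⟨u, hu, v, hv, h, t, e⟩ := h
  · rwa [← D.point_injective e]
  · rcases D.eq_or_eq_of_arc_eq_point h t e with rfl | rfl <;> assumption

/-- Different edges can only meet in a vertex, and a vertex on either part of the drawing belongs to
its vertex set. -/
theorem disjoint_carrierOn {C C' : Set V} (h : Disjoint C C') :
    Disjoint (D.carrierOn C) (D.carrierOn C') := by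
  rw [Set.disjoint_left]
  have main : ∀ w, D.point w ∈ D.carrierOn C → D.point w ∈ D.carrierOn C' → False :=
    fun w h1 h2 ↦ Set.disjoint_left.1 h (D.mem_of_point_mem_carrierOn h1)
      (D.mem_of_point_mem_carrierOn h2)
  intro z hz hz'
  have hz2 := hz
  have hz2' := hz'
  obtain ⟨u, hu, rfl⟩ | ⟨u, hu, v, hv, huv, s, rfl⟩ := hz2
  · exact main u hz hz'
  obtain ⟨x, hx, e⟩ | ⟨x, hx, y, hy, hxy, t, e⟩ := hz2'
  · exact main x (e ▸ hz) (e ▸ hz')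
  obtain ⟨w, hw⟩ := D.exists_point_of_arc_eq_arc huv hxy s t (fun he ↦ by
    rcases Sym2.eq_iff.1 he with ⟨rfl, rfl⟩ | ⟨rfl, rfl⟩
    · exact Set.disjoint_left.1 h hu hx
    · exact Set.disjoint_left.1 h hu hy) e.symm
  exact main w (hw ▸ hz) (hw ▸ hz')

theorem joinedIn_carrierOn {K : SimpleGraph V} (hK : K ≤ G) {C : Set V}
    (hC : ∀ u ∈ C, ∀ v, K.Adj u v → v ∈ C) {u v : V} (hu : u ∈ C) (h : K.Reachable u v) :
    JoinedIn (D.carrierOn C) (D.point u) (D.point v) := by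
  obtain ⟨p⟩ := h
  induction p with
  | nil => exact JoinedIn.refl (Or.inl ⟨_, hu, rfl⟩)
  | @cons x y z hxy p ih =>
    have hy := hC x hu y hxy
    refine JoinedIn.trans ⟨D.arc (hK hxy), fun t ↦ Or.inr ⟨x, hu, y, hy, hK hxy, t, rfl⟩⟩ (ih hy)

/-- Paths joining the ends of two interlaced pairs of vertices on a face meet. -/
theorem reachable_of_inCyclicOrderOn {F : Set ℂ} (hF : D.IsFace F) {a b c d : V}
    (hcyc : D.InCyclicOrderOn F ![a, b, c, d]) {K : SimpleGraph V} (hK : K ≤ G)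
    (hac : K.Reachable a c) (hbd : K.Reachable b d) : K.Reachable a b := by
  by_contra hab
  obtain ⟨φ, θ, hφ, hinj, hmono, hθ, hpt, hface⟩ := hcyc
  have hFc : ∀ z ∈ F, z ∉ D.carrier := by
    obtain ⟨x, hx, rfl⟩ := hF
    exact fun z hz ↦ connectedComponentIn_subset _ _ hz
  -- If `a` and `b` were in different components of `K`, the drawings of these components would
  -- contain the forbidden disjoint arcs.
  let C : Set V := {v | K.Reachable a v}
  let C' : Set V := {v | K.Reachable b v}
  have hCC : Disjoint C C' := by
    rw [Set.disjoint_left]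
    exact fun v hv hv' ↦ hab (SimpleGraph.Reachable.trans hv (SimpleGraph.Reachable.symm hv'))
  have h1 := D.joinedIn_carrierOn hK (C := C) (fun u hu v huv ↦
    SimpleGraph.Reachable.trans hu huv.reachable) (SimpleGraph.Reachable.refl a) hac
  have h2 := D.joinedIn_carrierOn hK (C := C') (fun u hu v huv ↦
    SimpleGraph.Reachable.trans hu huv.reachable) (SimpleGraph.Reachable.refl b) hbd
  have p0 := hpt 0
  have p1 := hpt 1
  have p2 := hpt 2
  have p3 := hpt 3
  simp only [Matrix.cons_val] at p0 p1 p2 p3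
  have key : ∀ X : Set V, ∀ z ∈ Metric.closedBall (0 : ℂ) 1, φ z ∈ D.carrierOn X →
      ∃ i, z = Complex.exp (θ i * Complex.I) ∧ ![a, b, c, d] i ∈ X := by
    intro X z hz hzX
    by_contra hcon
    by_cases h : ∃ i, z = Complex.exp (θ i * Complex.I)
    · obtain ⟨i, rfl⟩ := h
      rw [hpt] at hzX
      exact hcon ⟨i, rfl, D.mem_of_point_mem_carrierOn hzX⟩
    · exact hFc _ (hface z hz (not_exists.1 h)) (D.carrierOn_subset X hzX)
  have aC : a ∈ C := SimpleGraph.Reachable.refl a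
  have bC : b ∈ C' := SimpleGraph.Reachable.refl b
  have cC : c ∈ C := hac
  have dC : d ∈ C' := hbd
  refine false_of_crossing_paths hφ hinj (hmono (show (0 : Fin 4) < 1 by decide))
    (hmono (show (1 : Fin 4) < 2 by decide)) (hmono (show (2 : Fin 4) < 3 by decide))
    (by linarith [(hθ 3).2, (hθ 0).1]) rfl rfl rfl rfl
    (S := D.carrierOn C) (T := D.carrierOn C') (by rwa [p0, p2]) (by rwa [p1, p3])
    (D.disjoint_carrierOn hCC) ?_ ?_
  · intro z hz hzX
    obtain ⟨i, rfl, hi⟩ := key _ z hz hzX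
    fin_cases i
    · exact Or.inl rfl
    · exact absurd bC (Set.disjoint_left.1 hCC hi)
    · exact Or.inr rfl
    · exact absurd dC (Set.disjoint_left.1 hCC hi)
  · intro z hz hzX
    obtain ⟨i, rfl, hi⟩ := key _ z hz hzX
    fin_cases i
    · exact absurd hi (Set.disjoint_left.1 hCC aC)
    · exact Or.inl rfl
    · exact absurd hi (Set.disjoint_left.1 hCC cC)
    · exact Or.inr rfl

end PlaneDrawing

/-! ### Matchings as edge sets -/

section MatchingSums

open Classical

variable {V R : Type*}

/-- `P` is a set of edges in `E` that covers every vertex of `U` exactly once, and no others. -/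
structure IsEdgeMatching (E : Set (Sym2 V)) (U : Set V) (P : Finset (Sym2 V)) : Prop where
  subset : ∀ e ∈ P, e ∈ E
  mem_of_mem : ∀ e ∈ P, ∀ v ∈ e, v ∈ U
  existsUnique : ∀ v ∈ U, ∃! e, e ∈ P ∧ v ∈ e

/-- The sum of the weights of the matchings in `E` that cover exactly `U`. -/
noncomputable def edgeMatchingSum [Fintype V] [CommRing R] (ω : Sym2 V → R) (E : Set (Sym2 V))
    (U : Set V) : R :=
  ∑ P : Finset (Sym2 V) with IsEdgeMatching E U P, ∏ e ∈ P, ω e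

/-- A perfect matching is determined by its edges; this form lets the allowed edges and the covered
vertices vary independently. -/
theorem matchingSum_eq_edgeMatchingSum [Fintype V] [CommRing R] {G : SimpleGraph V}
    (ω : Sym2 V → R) (H : G.Subgraph) :
    matchingSum ω H = edgeMatchingSum ω H.edgeSet H.verts := by
  unfold matchingSum edgeMatchingSum
  refine Finset.sum_nbij (fun P ↦ P.edgeSet.toFinset) ?_ ?_ ?_ ?_
  · intro P hP
    obtain ⟨hle, hm, hv⟩ := (Finset.mem_filter.1 hP).2
    refine Finset.mem_filter.2 ⟨Finset.mem_univ _, ?_, ?_, ?_⟩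
    · intro e he
      exact SimpleGraph.Subgraph.edgeSet_mono hle (Set.mem_toFinset.1 he)
    · intro e he v hve
      rw [← hv]
      exact P.mem_verts_of_mem_edge (Set.mem_toFinset.1 he) hve
    · intro v hvU
      obtain ⟨w, hw, huniq⟩ := hm (hv ▸ hvU)
      refine ⟨s(v, w), ⟨Set.mem_toFinset.2 hw, Sym2.mem_mk_left v w⟩, ?_⟩
      rintro e ⟨he, u, rfl⟩
      rw [huniq u (show s(v, u) ∈ P.edgeSet from Set.mem_toFinset.1 he)]
  · intro P hP Q hQ h
    obtain ⟨-, -, hv⟩ := (Finset.mem_filter.1 hP).2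
    obtain ⟨-, -, hv'⟩ := (Finset.mem_filter.1 hQ).2
    refine SimpleGraph.Subgraph.ext (hv.trans hv'.symm) ?_
    have h' : P.edgeSet = Q.edgeSet := Set.toFinset_inj.1 h
    ext u v
    rw [← SimpleGraph.Subgraph.mem_edgeSet, h', SimpleGraph.Subgraph.mem_edgeSet]
  · intro F hF
    obtain ⟨hE, hU, hex⟩ := (Finset.mem_filter.1 hF).2
    let P : G.Subgraph :=
      { verts := H.verts
        Adj := fun u v ↦ s(u, v) ∈ F
        adj_sub := fun h ↦ H.adj_sub (hE _ h)
        edge_vert := fun h ↦ hU _ h _ (Sym2.mem_mk_left _ _)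
        symm := ⟨fun u v h ↦ by rwa [Sym2.eq_swap]⟩ }
    refine ⟨P, Finset.mem_filter.2 ⟨Finset.mem_univ _, ⟨subset_rfl, fun u v h ↦ hE _ h⟩, ?_, rfl⟩, ?_⟩
    · intro v hv
      obtain ⟨e, ⟨he, w, rfl⟩, huniq⟩ := hex v hv
      refine ⟨w, he, fun u hu ↦ ?_⟩
      exact Sym2.congr_right.1 (huniq s(v, u) ⟨hu, Sym2.mem_mk_left _ _⟩)
    · ext e
      simp only [Set.mem_toFinset]
      induction e with
      | _ u v => rfl
  · intro P hP
    rfl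

theorem edgeMatchingSum_diff_singleton [Fintype V] [CommRing R] (ω : Sym2 V → R)
    (E : Set (Sym2 V)) (U : Set V) {a b : V} (ha : a ∉ U) :
    edgeMatchingSum ω (E \ {s(a, b)}) U = edgeMatchingSum ω E U := by
  unfold edgeMatchingSum
  congr 1
  refine Finset.filter_congr fun P _ ↦ ⟨fun h ↦ ⟨fun e he ↦ (h.1 e he).1, h.2, h.3⟩,
    fun h ↦ ⟨fun e he ↦ ⟨h.1 e he, ?_⟩, h.2, h.3⟩⟩
  rintro rfl
  exact ha (h.2 _ he _ (Sym2.mem_mk_left _ _))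

theorem edgeMatchingSum_eq_add [Fintype V] [CommRing R] (ω : Sym2 V → R)
    (E : Set (Sym2 V)) (U : Set V) {a b : V} (hE : s(a, b) ∈ E) (ha : a ∈ U) (hb : b ∈ U) :
    edgeMatchingSum ω E U = edgeMatchingSum ω (E \ {s(a, b)}) U +
      ω s(a, b) * edgeMatchingSum ω (E \ {s(a, b)}) (U \ {a, b}) := by
  unfold edgeMatchingSum
  rw [← Finset.sum_filter_not_add_sum_filter _ (fun P : Finset (Sym2 V) ↦ s(a, b) ∈ P),
    Finset.filter_filter, Finset.filter_filter, Finset.mul_sum]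
  congr 1
  · congr 1
    refine Finset.filter_congr fun P _ ↦ ⟨fun h ↦ ⟨fun e he ↦ ⟨h.1.1 e he, ?_⟩, h.1.2, h.1.3⟩,
      fun h ↦ ⟨⟨fun e he ↦ (h.1 e he).1, h.2, h.3⟩, fun he ↦ (h.1 _ he).2 rfl⟩⟩
    rintro rfl
    exact h.2 he
  · have hmem : ∀ v, v ∈ s(a, b) ↔ v ∈ ({a, b} : Set V) := fun v ↦ by simp
    have hnot : ∀ P : Finset (Sym2 V), IsEdgeMatching (E \ {s(a, b)}) (U \ {a, b}) P →
        s(a, b) ∉ P := fun P hP h ↦ (hP.1 _ h).2 rfl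
    refine Finset.sum_nbij' (fun P ↦ P.erase s(a, b)) (fun P ↦ insert s(a, b) P) ?_ ?_ ?_ ?_ ?_
    · intro P hP
      obtain ⟨hP, he⟩ := (Finset.mem_filter.1 hP).2
      have huniq : ∀ e ∈ P, ∀ v ∈ e, v ∈ s(a, b) → e = s(a, b) := fun e h v hv hvab ↦
        (hP.3 v (hP.2 e h v hv)).unique ⟨h, hv⟩ ⟨he, hvab⟩
      refine Finset.mem_filter.2 ⟨Finset.mem_univ _, ?_, ?_, ?_⟩
      · intro e h
        rw [Finset.mem_erase] at h
        exact ⟨hP.1 e h.2, h.1⟩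
      · intro e h v hv
        rw [Finset.mem_erase] at h
        exact ⟨hP.2 e h.2 v hv, fun hv' ↦ h.1 (huniq e h.2 v hv ((hmem v).2 hv'))⟩
      · rintro v ⟨hvU, hv⟩
        obtain ⟨e, ⟨h, hve⟩, hu⟩ := hP.3 v hvU
        refine ⟨e, ⟨Finset.mem_erase.2 ⟨?_, h⟩, hve⟩, fun e' h' ↦
          hu e' ⟨Finset.mem_of_mem_erase h'.1, h'.2⟩⟩
        rintro rfl
        exact hv ((hmem v).1 hve)
    · intro P hP
      have hP := (Finset.mem_filter.1 hP).2
      refine Finset.mem_filter.2 ⟨Finset.mem_univ _, ⟨?_, ?_, ?_⟩, Finset.mem_insert_self _ _⟩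
      · intro e h
        rcases Finset.mem_insert.1 h with rfl | h
        · exact hE
        · exact (hP.1 e h).1
      · intro e h v hv
        rcases Finset.mem_insert.1 h with rfl | h
        · rcases (hmem v).1 hv with rfl | rfl <;> assumption
        · exact (hP.2 e h v hv).1
      · intro v hv
        by_cases hvab : v ∈ ({a, b} : Set V)
        · refine ⟨s(a, b), ⟨Finset.mem_insert_self _ _, (hmem v).2 hvab⟩, ?_⟩
          rintro e ⟨h, hve⟩
          rcases Finset.mem_insert.1 h with rfl | h
          · rfl
          · exact absurd hvab (hP.2 e h v hve).2
        · obtain ⟨e, ⟨h, hve⟩, hu⟩ := hP.3 v ⟨hv, hvab⟩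
          refine ⟨e, ⟨Finset.mem_insert_of_mem h, hve⟩, ?_⟩
          rintro e' ⟨h', hve'⟩
          rcases Finset.mem_insert.1 h' with rfl | h'
          · exact absurd ((hmem v).1 hve') hvab
          · exact hu e' ⟨h', hve'⟩
    · intro P hP
      exact Finset.insert_erase (Finset.mem_filter.1 hP).2.2
    · intro P hP
      exact Finset.erase_insert (hnot P (Finset.mem_filter.1 hP).2)
    · intro P hP
      exact (Finset.mul_prod_erase P ω (Finset.mem_filter.1 hP).2.2).symm

/-! ### Superposition of two matchings -/

/-- The edges of `P` that meet `C` and the edges of `Q` that do not. -/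
noncomputable def mixOn (C : Set V) (P Q : Finset (Sym2 V)) : Finset (Sym2 V) :=
  P.filter (fun e ↦ ∃ v ∈ e, v ∈ C) ∪ Q.filter (fun e ↦ ¬ ∃ v ∈ e, v ∈ C)

theorem mem_mixOn {C : Set V} {P Q : Finset (Sym2 V)} {e : Sym2 V} :
    e ∈ mixOn C P Q ↔ (e ∈ P ∧ ∃ v ∈ e, v ∈ C) ∨ (e ∈ Q ∧ ¬ ∃ v ∈ e, v ∈ C) := by
  simp only [mixOn, Finset.mem_union, Finset.mem_filter]

theorem mixOn_mixOn (C : Set V) (P Q : Finset (Sym2 V)) :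
    mixOn C (mixOn C P Q) (mixOn C Q P) = P := by
  ext e
  simp only [mem_mixOn]
  by_cases h : ∃ v ∈ e, v ∈ C <;> simp [h]

theorem mixOn_union_mixOn (C : Set V) (P Q : Finset (Sym2 V)) :
    mixOn C P Q ∪ mixOn C Q P = P ∪ Q := by
  ext e
  simp only [mem_mixOn, Finset.mem_union]
  by_cases h : ∃ v ∈ e, v ∈ C <;> simp [h, or_comm]

theorem prod_mixOn_mul_prod_mixOn [CommRing R] (ω : Sym2 V → R) (C : Set V)
    (P Q : Finset (Sym2 V)) :
    (∏ e ∈ mixOn C P Q, ω e) * ∏ e ∈ mixOn C Q P, ω e = (∏ e ∈ P, ω e) * ∏ e ∈ Q, ω e := by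
  rw [mixOn, mixOn, Finset.prod_union (Finset.disjoint_filter_filter_not _ _ _),
    Finset.prod_union (Finset.disjoint_filter_filter_not _ _ _),
    ← Finset.prod_filter_mul_prod_filter_not P (fun e ↦ ∃ v ∈ e, v ∈ C),
    ← Finset.prod_filter_mul_prod_filter_not Q (fun e ↦ ∃ v ∈ e, v ∈ C)]
  ring

/-- No edge of `P` or `Q` leaves `C`, so the two pieces cannot interfere. -/
theorem IsEdgeMatching.mixOn {E : Set (Sym2 V)} {X Y : Set V} {P Q : Finset (Sym2 V)}
    (hP : IsEdgeMatching E X P) (hQ : IsEdgeMatching E Y Q) {C : Set V}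
    (hC : ∀ e ∈ P ∪ Q, ∀ u ∈ e, ∀ v ∈ e, u ∈ C → v ∈ C) :
    IsEdgeMatching E (X ∩ C ∪ Y \ C) (mixOn C P Q) := by
  have hCP : ∀ e ∈ P, (∃ v ∈ e, v ∈ C) → ∀ v ∈ e, v ∈ C := fun e he ⟨u, hu, huC⟩ v hv ↦
    hC e (Finset.mem_union_left _ he) u hu v hv huC
  refine ⟨?_, ?_, ?_⟩
  · intro e he
    rcases mem_mixOn.1 he with h | h
    · exact hP.1 e h.1
    · exact hQ.1 e h.1
  · intro e he v hv
    rcases mem_mixOn.1 he with h | h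
    · exact Or.inl ⟨hP.2 e h.1 v hv, hCP e h.1 h.2 v hv⟩
    · exact Or.inr ⟨hQ.2 e h.1 v hv, fun hvC ↦ h.2 ⟨v, hv, hvC⟩⟩
  · rintro v (⟨hv, hvC⟩ | ⟨hv, hvC⟩)
    · obtain ⟨e, ⟨he, hve⟩, hu⟩ := hP.3 v hv
      refine ⟨e, ⟨mem_mixOn.2 (Or.inl ⟨he, v, hve, hvC⟩), hve⟩, ?_⟩
      rintro e' ⟨he', hve'⟩
      rcases mem_mixOn.1 he' with h | h
      · exact hu e' ⟨h.1, hve'⟩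
      · exact absurd ⟨v, hve', hvC⟩ h.2
    · obtain ⟨e, ⟨he, hve⟩, hu⟩ := hQ.3 v hv
      refine ⟨e, ⟨mem_mixOn.2 (Or.inr ⟨he, fun ⟨u, hue, huC⟩ ↦
        hvC (hC e (Finset.mem_union_right _ he) u hue v hve huC)⟩), hve⟩, ?_⟩
      rintro e' ⟨he', hve'⟩
      rcases mem_mixOn.1 he' with h | h
      · exact absurd (hCP e' h.1 h.2 v hve') hvC
      · exact hu e' ⟨h.1, hve'⟩

/-- Double count incidences: each covered vertex of `C` lies on one edge, each edge meeting `C` has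
both ends in `C`. -/
theorem IsEdgeMatching.card_filter_mem [Fintype V] {E : Set (Sym2 V)} {X : Set V}
    {P : Finset (Sym2 V)} (hP : IsEdgeMatching E X P) (hE : ∀ e ∈ E, ¬ e.IsDiag) {C : Finset V}
    (hC : ∀ e ∈ P, ∀ u ∈ e, ∀ v ∈ e, u ∈ C → v ∈ C) :
    (C.filter (· ∈ X)).card = 2 * (P.filter (fun e ↦ ∃ v ∈ e, v ∈ C)).card := by
  have key := Finset.sum_card_bipartiteAbove_eq_sum_card_bipartiteBelow
    (s := C.filter (· ∈ X)) (t := P.filter (fun e ↦ ∃ v ∈ e, v ∈ C))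
    (fun (v : V) (e : Sym2 V) ↦ v ∈ e)
  rw [Finset.sum_congr rfl (g := fun _ ↦ 1), Finset.sum_congr (s₁ := P.filter _) rfl
    (g := fun _ ↦ 2), Finset.sum_const, Finset.sum_const] at key
  · simpa [mul_comm] using key
  · intro e he
    obtain ⟨he, u, hu, huC⟩ := Finset.mem_filter.1 he
    rw [← Sym2.card_toFinset_of_not_isDiag e (hE e (hP.1 e he))]
    congr 1
    ext v
    simp only [Finset.mem_bipartiteBelow, Finset.mem_filter, Sym2.mem_toFinset]
    exact ⟨fun h ↦ h.2, fun h ↦ ⟨⟨hC e he u hu v h huC, hP.2 e he v h⟩, h⟩⟩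
  · intro v hv
    obtain ⟨hvC, hvX⟩ := Finset.mem_filter.1 hv
    obtain ⟨e, ⟨he, hve⟩, hu⟩ := hP.3 v hvX
    rw [Finset.card_eq_one]
    refine ⟨e, ?_⟩
    ext e'
    simp only [Finset.mem_bipartiteAbove, Finset.mem_filter, Finset.mem_singleton]
    constructor
    · exact fun h ↦ hu e' ⟨h.1.1, h.2⟩
    · rintro rfl
      exact ⟨⟨he, v, hve, hvC⟩, hve⟩

/-- The graph formed by the edges of `P` and `Q`. -/
def superposition (P Q : Finset (Sym2 V)) : SimpleGraph V :=
  SimpleGraph.fromEdgeSet (↑(P ∪ Q) : Set (Sym2 V))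

theorem superposition_closed (P Q : Finset (Sym2 V)) (x : V) :
    ∀ e ∈ P ∪ Q, ∀ u ∈ e, ∀ v ∈ e,
      (superposition P Q).Reachable x u → (superposition P Q).Reachable x v := by
  intro e he u hu v hv h
  rcases eq_or_ne u v with rfl | huv
  · exact h
  refine h.trans (SimpleGraph.Adj.reachable ?_)
  rw [superposition, SimpleGraph.fromEdgeSet_adj]
  refine ⟨?_, huv⟩
  rwa [← (Sym2.mem_and_mem_iff huv).1 ⟨hu, hv⟩]

/-- A connected graph has at most one more vertex than edges. -/
theorem card_reachable_superposition_le [Fintype V] (P Q : Finset (Sym2 V)) (x : V) :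
    (Finset.univ.filter (fun v ↦ (superposition P Q).Reachable x v)).card ≤
      (P.filter (fun e ↦ ∃ v ∈ e, (superposition P Q).Reachable x v)).card +
      (Q.filter (fun e ↦ ∃ v ∈ e, (superposition P Q).Reachable x v)).card + 1 := by
  set K := superposition P Q with hK
  let c := K.connectedComponentMk x
  have hc : ∀ v, v ∈ c ↔ K.Reachable x v := fun v ↦ by
    change K.connectedComponentMk v = K.connectedComponentMk x ↔ _
    rw [SimpleGraph.ConnectedComponent.eq]
    exact ⟨fun h ↦ h.symm, fun h ↦ h.symm⟩
  have h1 := c.connected_toSimpleGraph.card_vert_le_card_edgeSet_add_one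
  have h2 : Nat.card c = (Finset.univ.filter (fun v ↦ K.Reachable x v)).card := by
    rw [← Nat.card_eq_finsetCard]
    exact Nat.card_congr (Equiv.subtypeEquivRight fun v ↦ by simp [hc])
  have h3 : Nat.card c.toSimpleGraph.edgeSet ≤
      (P.filter (fun e ↦ ∃ v ∈ e, K.Reachable x v) ∪
        Q.filter (fun e ↦ ∃ v ∈ e, K.Reachable x v)).card := by
    rw [← Nat.card_eq_finsetCard]
    refine Nat.card_le_card_of_injective (fun e ↦ ⟨Sym2.map Subtype.val e.1, ?_⟩) ?_
    · obtain ⟨e, he⟩ := e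
      induction e with
      | _ u v =>
        have hadj : K.Adj u v := he
        have h := Finset.mem_union.1 (Finset.mem_coe.1 ((SimpleGraph.fromEdgeSet_adj _).1 hadj).1)
        rw [← Finset.filter_union, Finset.mem_filter]
        exact ⟨Finset.mem_union.2 h, u, Sym2.mem_mk_left _ _, (hc _).1 u.2⟩
    · intro e e' h
      exact Subtype.ext (Sym2.map.injective Subtype.val_injective (Subtype.ext_iff.1 h))
  have h4 := Finset.card_union_le (P.filter (fun e ↦ ∃ v ∈ e, K.Reachable x v))
    (Q.filter (fun e ↦ ∃ v ∈ e, K.Reachable x v))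
  omega

/-- In the superposition of two matchings, a vertex that is covered by only one of them is
connected to exactly one other such vertex. -/
theorem IsEdgeMatching.exists_unique_reachable [Fintype V] {E : Set (Sym2 V)} {X Y : Set V}
    {P Q : Finset (Sym2 V)} (hE : ∀ e ∈ E, ¬ e.IsDiag) (hP : IsEdgeMatching E X P)
    (hQ : IsEdgeMatching E Y Q) (hXY : X ∪ Y = Set.univ) {x : V} (hx : x ∉ X ∩ Y) :
    ∃ y ∉ X ∩ Y, y ≠ x ∧ (superposition P Q).Reachable x y ∧
      ∀ z ∉ X ∩ Y, (superposition P Q).Reachable x z → z = x ∨ z = y := by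
  set K := superposition P Q with hK
  set C : Finset V := Finset.univ.filter (fun v ↦ K.Reachable x v) with hC
  have mC : ∀ v, v ∈ C ↔ K.Reachable x v := fun v ↦ by simp [hC]
  have cP := hP.card_filter_mem hE (C := C) (fun e he u hu v hv h ↦ (mC v).2
    (superposition_closed P Q x e (Finset.mem_union_left _ he) u hu v hv ((mC u).1 h)))
  have cQ := hQ.card_filter_mem hE (C := C) (fun e he u hu v hv h ↦ (mC v).2
    (superposition_closed P Q x e (Finset.mem_union_right _ he) u hu v hv ((mC u).1 h)))
  have hle := card_reachable_superposition_le P Q x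
  simp only [mC] at cP cQ
  rw [← hK, ← hC] at hle
  have h1 := Finset.card_union_add_card_inter (C.filter (· ∈ X)) (C.filter (· ∈ Y))
  have h2 : C.filter (· ∈ X) ∪ C.filter (· ∈ Y) = C := by
    ext v
    have : v ∈ X ∨ v ∈ Y := by
      have := Set.mem_univ v
      rwa [← hXY] at this
    simp only [Finset.mem_union, Finset.mem_filter]
    tauto
  have h3 : C.filter (· ∈ X) ∩ C.filter (· ∈ Y) = C.filter (· ∈ X ∩ Y) := by
    ext v
    simp only [Finset.mem_inter, Finset.mem_filter, Set.mem_inter_iff]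
    tauto
  have h4 := Finset.card_filter_add_card_filter_not (s := C) (fun v ↦ v ∈ X ∩ Y)
  rw [h2, h3] at h1
  set N := C.filter (fun v ↦ ¬ v ∈ X ∩ Y) with hN
  have hxN : x ∈ N := Finset.mem_filter.2 ⟨(mC x).2 (SimpleGraph.Reachable.refl x), hx⟩
  have hpos : 0 < N.card := Finset.card_pos.2 ⟨x, hxN⟩
  -- With $p,q$ the numbers of edges of `P`, `Q` meeting `C`, the counts give $|N|=2|C|-2p-2q$. This
  -- is even, positive, and at most 2 because $|C|\le p+q+1$.
  have hcard : N.card = 2 := by omega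
  obtain ⟨y, hy⟩ := Finset.card_eq_one.1 (show (N.erase x).card = 1 by
    rw [Finset.card_erase_of_mem hxN, hcard])
  have hyN : y ∈ N.erase x := by rw [hy]; exact Finset.mem_singleton_self y
  obtain ⟨hyx, hyN⟩ := Finset.mem_erase.1 hyN
  obtain ⟨hyC, hyXY⟩ := Finset.mem_filter.1 hyN
  refine ⟨y, hyXY, hyx, (mC y).1 hyC, fun z hz hxz ↦ ?_⟩
  rcases eq_or_ne z x with h | h
  · exact Or.inl h
  · right
    have : z ∈ N.erase x := Finset.mem_erase.2 ⟨h, Finset.mem_filter.2 ⟨(mC z).2 hxz, hz⟩⟩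
    rwa [hy, Finset.mem_singleton] at this

/-- If, moreover, exactly the vertices `a, b, c, d` are covered only once and no component can
join `a` to `c` while another joins `b` to `d`, then `a` is connected to one of `b, d` only. -/
theorem IsEdgeMatching.reachable_cases [Fintype V] {G : SimpleGraph V} {E : Set (Sym2 V)}
    (hE : E ⊆ G.edgeSet) {X Y : Set V} {P Q : Finset (Sym2 V)} (hP : IsEdgeMatching E X P)
    (hQ : IsEdgeMatching E Y Q) (hXY : X ∪ Y = Set.univ) {a b c d : V}
    (hab : a ≠ b) (hac : a ≠ c) (had : a ≠ d) (hbc : b ≠ c) (hbd : b ≠ d) (hcd : c ≠ d)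
    (hN : ∀ v, v ∉ X ∩ Y ↔ v = a ∨ v = b ∨ v = c ∨ v = d)
    (hpl : ∀ K ≤ G, K.Reachable a c → K.Reachable b d → K.Reachable a b) :
    ¬ (superposition P Q).Reachable a c ∧
      (((superposition P Q).Reachable a b ∧ ¬ (superposition P Q).Reachable a d) ∨
        (¬ (superposition P Q).Reachable a b ∧ (superposition P Q).Reachable a d)) := by
  have hdiag : ∀ e ∈ E, ¬ e.IsDiag := fun e he ↦ G.not_isDiag_of_mem_edgeSet (hE he)
  have hK : superposition P Q ≤ G := by
    intro u v h
    rw [superposition, SimpleGraph.fromEdgeSet_adj] at h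
    rcases Finset.mem_union.1 (Finset.mem_coe.1 h.1) with h | h
    · exact hE (hP.1 _ h)
    · exact hE (hQ.1 _ h)
  have ex := fun x hx ↦ hP.exists_unique_reachable hdiag hQ hXY (x := x) ((hN x).2 hx)
  simp only [hN] at ex
  have hpl := hpl _ hK
  obtain ⟨y, hy, hya, ray, hay⟩ := ex a (Or.inl rfl)
  obtain ⟨z, hz, hzb, rbz, -⟩ := ex b (Or.inr (Or.inl rfl))
  have nb := hay b (Or.inr (Or.inl rfl))
  have nc := hay c (Or.inr (Or.inr (Or.inl rfl)))
  have nd := hay d (Or.inr (Or.inr (Or.inr rfl)))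
  clear hay ex hN
  rcases hy with rfl | rfl | rfl | rfl
  · exact absurd rfl hya
  · refine ⟨fun h ↦ ?_, Or.inl ⟨ray, fun h ↦ ?_⟩⟩
    · rcases nc h with h | h
      · exact hac h.symm
      · exact hbc h.symm
    · rcases nd h with h | h
      · exact had h.symm
      · exact hbd h.symm
  -- Here `a` is paired with `c`, which leaves only `d` as partner of `b`; then `hpl` merges the two
  -- pairs.
  · exfalso
    have hnab : ¬ (superposition P Q).Reachable a b := fun h ↦ by
      rcases nb h with h | h
      · exact hab h.symm
      · exact hbc h
    rcases hz with rfl | rfl | rfl | rfl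
    · exact hnab rbz.symm
    · exact hzb rfl
    · exact hnab (ray.trans rbz.symm)
    · exact hnab (hpl ray rbz)
  · refine ⟨fun h ↦ ?_, Or.inr ⟨fun h ↦ ?_, ray⟩⟩
    · rcases nc h with h | h
      · exact hac h.symm
      · exact hcd h
    · rcases nb h with h | h
      · exact hab h.symm
      · exact hbd h

/-! ### The exchange involution and condensation -/

/-- Exchange the two matchings outside the component of `a` in their superposition. -/
noncomputable def exchange (a : V) (p : Finset (Sym2 V) × Finset (Sym2 V)) :
    Finset (Sym2 V) × Finset (Sym2 V) :=
  (mixOn {v | (superposition p.1 p.2).Reachable a v} p.1 p.2,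
    mixOn {v | (superposition p.1 p.2).Reachable a v} p.2 p.1)

/-- The exchange preserves the union of the matchings, hence the component used for the second
exchange. -/
theorem exchange_exchange (a : V) (p : Finset (Sym2 V) × Finset (Sym2 V)) :
    exchange a (exchange a p) = p := by
  have : superposition (exchange a p).1 (exchange a p).2 = superposition p.1 p.2 := by
    rw [superposition, exchange, mixOn_union_mixOn, superposition]
  rw [exchange, this]
  exact Prod.ext (mixOn_mixOn _ _ _) (mixOn_mixOn _ _ _)

theorem prod_exchange [CommRing R] (ω : Sym2 V → R) (a : V)
    (p : Finset (Sym2 V) × Finset (Sym2 V)) :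
    (∏ e ∈ (exchange a p).1, ω e) * ∏ e ∈ (exchange a p).2, ω e =
      (∏ e ∈ p.1, ω e) * ∏ e ∈ p.2, ω e :=
  prod_mixOn_mul_prod_mixOn ω _ _ _

theorem IsEdgeMatching.exchange {E : Set (Sym2 V)} {X Y : Set V} {P Q : Finset (Sym2 V)}
    (hP : IsEdgeMatching E X P) (hQ : IsEdgeMatching E Y Q) (a : V) {X' Y' : Set V}
    (hX' : ∀ v, v ∈ X' ↔
      (v ∈ X ∧ (superposition P Q).Reachable a v) ∨ (v ∈ Y ∧ ¬ (superposition P Q).Reachable a v))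
    (hY' : ∀ v, v ∈ Y' ↔
      (v ∈ Y ∧ (superposition P Q).Reachable a v) ∨ (v ∈ X ∧ ¬ (superposition P Q).Reachable a v)) :
    IsEdgeMatching E X' (exchange a (P, Q)).1 ∧ IsEdgeMatching E Y' (exchange a (P, Q)).2 := by
  have hcl := superposition_closed P Q a
  have h1 := hP.mixOn hQ (C := {v | (superposition P Q).Reachable a v}) hcl
  have h2 := hQ.mixOn hP (C := {v | (superposition P Q).Reachable a v})
    (by rw [Finset.union_comm]; exact hcl)
  constructor
  · convert! h1 using 1
    exact Set.ext hX'
  · convert! h2 using 1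
    exact Set.ext hY'

/-- A matching determines the set it covers, so `X ≠ X'` makes the two families of pairs disjoint.
-/
theorem edgeMatchingSum_mul_add_mul [Fintype V] [CommRing R] (ω : Sym2 V → R)
    (E : Set (Sym2 V)) {X Y X' Y' : Set V} (hXX' : X ≠ X') :
    edgeMatchingSum ω E X * edgeMatchingSum ω E Y +
        edgeMatchingSum ω E X' * edgeMatchingSum ω E Y' =
      ∑ p : Finset (Sym2 V) × Finset (Sym2 V) with
        (IsEdgeMatching E X p.1 ∧ IsEdgeMatching E Y p.2) ∨
        (IsEdgeMatching E X' p.1 ∧ IsEdgeMatching E Y' p.2),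
        (∏ e ∈ p.1, ω e) * ∏ e ∈ p.2, ω e := by
  have key : ∀ X Y : Set V, edgeMatchingSum ω E X * edgeMatchingSum ω E Y =
      ∑ p : Finset (Sym2 V) × Finset (Sym2 V) with
        IsEdgeMatching E X p.1 ∧ IsEdgeMatching E Y p.2,
        (∏ e ∈ p.1, ω e) * ∏ e ∈ p.2, ω e := by
    intro X Y
    rw [edgeMatchingSum, edgeMatchingSum, Finset.sum_mul_sum, ← Finset.sum_product',
      ← Finset.filter_product, Finset.univ_product_univ]
  rw [key, key, Finset.filter_or, Finset.sum_union]
  rw [Finset.disjoint_filter]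
  rintro p - ⟨h, -⟩ ⟨h', -⟩
  apply hXX'
  have sub : ∀ {X X' : Set V}, IsEdgeMatching E X p.1 → IsEdgeMatching E X' p.1 → X ⊆ X' := by
    intro X X' h h' v hv
    obtain ⟨e, ⟨he, hve⟩, -⟩ := h.3 v hv
    exact h'.2 e he v hve
  exact (sub h h').antisymm (sub h' h)

/-- Kuo's condensation for weighted matchings of a graph that satisfies a noncrossing condition
for the vertices `a, b, c, d`. -/
theorem edgeMatchingSum_condensation [Fintype V] [CommRing R] {G : SimpleGraph V}
    (ω : Sym2 V → R) {E : Set (Sym2 V)} (hE : E ⊆ G.edgeSet) {a b c d : V}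
    (hab : a ≠ b) (hac : a ≠ c) (had : a ≠ d) (hbc : b ≠ c) (hbd : b ≠ d) (hcd : c ≠ d)
    (hpl : ∀ K ≤ G, K.Reachable a c → K.Reachable b d → K.Reachable a b) :
    edgeMatchingSum ω E Set.univ * edgeMatchingSum ω E {a, b, c, d}ᶜ +
        edgeMatchingSum ω E {b, d}ᶜ * edgeMatchingSum ω E {a, c}ᶜ =
      edgeMatchingSum ω E {c, d}ᶜ * edgeMatchingSum ω E {a, b}ᶜ +
        edgeMatchingSum ω E {b, c}ᶜ * edgeMatchingSum ω E {a, d}ᶜ := by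
  have ne1 : (Set.univ : Set V) ≠ {b, d}ᶜ := fun h ↦ by
    have := Set.mem_univ b
    rw [h] at this
    simp at this
  have ne2 : ({c, d}ᶜ : Set V) ≠ {b, c}ᶜ := fun h ↦ by
    have : b ∈ ({c, d}ᶜ : Set V) := by simp [hbc, hbd]
    rw [h] at this
    simp at this
  rw [edgeMatchingSum_mul_add_mul ω E ne1, edgeMatchingSum_mul_add_mul ω E ne2]
  -- This serves all four products. The first factor always covers `a`. If `a` is joined to `b`,
  -- then `c` and `d` change sides, giving `X', Y'`; if to `d`, then `b` and `c` do, giving `X'',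
  -- Y''`.
  have move : ∀ {X Y X' Y' X'' Y'' : Set V} {p : Finset (Sym2 V) × Finset (Sym2 V)},
      IsEdgeMatching E X p.1 → IsEdgeMatching E Y p.2 →
      (∀ v, v ≠ a → v ≠ b → v ≠ c → v ≠ d →
        v ∈ X ∧ v ∈ Y ∧ v ∈ X' ∧ v ∈ Y' ∧ v ∈ X'' ∧ v ∈ Y'') →
      (a ∈ X ∧ a ∉ Y ∧ a ∈ X' ∧ a ∉ Y' ∧ a ∈ X'' ∧ a ∉ Y'') →
      ((b ∈ X ↔ b ∉ Y) ∧ (b ∈ X' ↔ b ∈ X) ∧ (b ∈ Y' ↔ b ∈ Y) ∧ (b ∈ X'' ↔ b ∈ Y) ∧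
        (b ∈ Y'' ↔ b ∈ X)) →
      ((c ∈ X ↔ c ∉ Y) ∧ (c ∈ X' ↔ c ∈ Y) ∧ (c ∈ Y' ↔ c ∈ X) ∧ (c ∈ X'' ↔ c ∈ Y) ∧
        (c ∈ Y'' ↔ c ∈ X)) →
      ((d ∈ X ↔ d ∉ Y) ∧ (d ∈ X' ↔ d ∈ Y) ∧ (d ∈ Y' ↔ d ∈ X) ∧ (d ∈ X'' ↔ d ∈ X) ∧
        (d ∈ Y'' ↔ d ∈ Y)) →
      (IsEdgeMatching E X' (exchange a p).1 ∧ IsEdgeMatching E Y' (exchange a p).2) ∨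
      (IsEdgeMatching E X'' (exchange a p).1 ∧ IsEdgeMatching E Y'' (exchange a p).2) := by
    rintro X Y X' Y' X'' Y'' ⟨P, Q⟩ hP hQ ho ha hb hc hd
    have ra := SimpleGraph.Reachable.refl (G := superposition P Q) a
    have hcov : ∀ v, (v ∈ X ∨ v ∈ Y) ∧
        (¬ (v ∈ X ∧ v ∈ Y) ↔ v = a ∨ v = b ∨ v = c ∨ v = d) := by
      intro v
      by_cases h1 : v = a
      · subst h1; simp [ha]
      by_cases h2 : v = b
      · subst h2; simp [hb.1, em']
      by_cases h3 : v = c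
      · subst h3; simp [hc.1, em']
      by_cases h4 : v = d
      · subst h4; simp [hd.1, em']
      have := ho v h1 h2 h3 h4
      simp [h1, h2, h3, h4, this.1, this.2.1]
    obtain ⟨nc, hbd⟩ := hP.reachable_cases hE hQ
      (Set.eq_univ_of_forall fun v ↦ (hcov v).1) hab hac had hbc hbd hcd
      (fun v ↦ (hcov v).2) hpl
    have fin : ∀ {S S' T : Set V}, (∀ v, v ≠ a → v ≠ b → v ≠ c → v ≠ d →
        v ∈ S ∧ v ∈ S' ∧ v ∈ T) → (∀ v, v = a ∨ v = b ∨ v = c ∨ v = d →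
          (v ∈ T ↔ (v ∈ S ∧ (superposition P Q).Reachable a v) ∨
            (v ∈ S' ∧ ¬ (superposition P Q).Reachable a v))) →
        ∀ v, (v ∈ T ↔ (v ∈ S ∧ (superposition P Q).Reachable a v) ∨
          (v ∈ S' ∧ ¬ (superposition P Q).Reachable a v)) := by
      intro S S' T h h' v
      by_cases hv : v = a ∨ v = b ∨ v = c ∨ v = d
      · exact h' v hv
      · simp only [not_or] at hv
        obtain ⟨h1, h2, h3⟩ := h v hv.1 hv.2.1 hv.2.2.1 hv.2.2.2
        simp [h1, h2, h3, Classical.em]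
    rcases hbd with ⟨rb, rd⟩ | ⟨rb, rd⟩
    · left
      apply hP.exchange hQ a
      · refine fin (fun v h1 h2 h3 h4 ↦ ?_) ?_
        · have := ho v h1 h2 h3 h4
          exact ⟨this.1, this.2.1, this.2.2.1⟩
        · rintro v (rfl | rfl | rfl | rfl) <;> simp [*]
      · refine fin (fun v h1 h2 h3 h4 ↦ ?_) ?_
        · have := ho v h1 h2 h3 h4
          exact ⟨this.2.1, this.1, this.2.2.2.1⟩
        · rintro v (rfl | rfl | rfl | rfl) <;> simp [*]
    · right
      apply hP.exchange hQ a
      · refine fin (fun v h1 h2 h3 h4 ↦ ?_) ?_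
        · have := ho v h1 h2 h3 h4
          exact ⟨this.1, this.2.1, this.2.2.2.2.1⟩
        · rintro v (rfl | rfl | rfl | rfl) <;> simp [*]
      · refine fin (fun v h1 h2 h3 h4 ↦ ?_) ?_
        · have := ho v h1 h2 h3 h4
          exact ⟨this.2.1, this.1, this.2.2.2.2.2⟩
        · rintro v (rfl | rfl | rfl | rfl) <;> simp [*]
  have hba := hab.symm
  have hca := hac.symm
  have hda := had.symm
  have hcb := hbc.symm
  have hdb := hbd.symm
  have hdc := hcd.symm
  refine Finset.sum_nbij' (exchange a) (exchange a) ?_ ?_ (fun p _ ↦ exchange_exchange a p)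
    (fun p _ ↦ exchange_exchange a p) (fun p _ ↦ (prod_exchange ω a p).symm)
  · intro p hp
    rw [Finset.mem_filter] at hp ⊢
    refine ⟨Finset.mem_univ _, ?_⟩
    rcases hp.2 with ⟨hP, hQ⟩ | ⟨hP, hQ⟩
    · refine move hP hQ (by simp +contextual) ?_ ?_ ?_ ?_ <;>
        simp [hab, hba, hac, hca, had, hda, hbc, hcb, hbd, hdb, hcd, hdc]
    · refine (move hP hQ (by simp +contextual) ?_ ?_ ?_ ?_).symm <;>
        simp [hab, hba, hac, hca, had, hda, hbc, hcb, hbd, hdb, hcd, hdc]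
  · intro p hp
    rw [Finset.mem_filter] at hp ⊢
    refine ⟨Finset.mem_univ _, ?_⟩
    rcases hp.2 with ⟨hP, hQ⟩ | ⟨hP, hQ⟩
    · refine move hP hQ (by simp +contextual) ?_ ?_ ?_ ?_ <;>
        simp [hab, hba, hac, hca, had, hda, hbc, hcb, hbd, hdb, hcd, hdc]
    · refine (move hP hQ (by simp +contextual) ?_ ?_ ?_ ?_).symm <;>
        simp [hab, hba, hac, hca, had, hda, hbc, hcb, hbd, hdb, hcd, hdc]

/-! ### Deletions from the graph and the final identity -/

theorem matchingSum_deleteVerts [Fintype V] [CommRing R] {G : SimpleGraph V} (ω : Sym2 V → R)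
    (s : Set V) :
    matchingSum ω ((⊤ : G.Subgraph).deleteVerts s) = edgeMatchingSum ω G.edgeSet sᶜ := by
  have hv : ((⊤ : G.Subgraph).deleteVerts s).verts = sᶜ := by
    rw [SimpleGraph.Subgraph.deleteVerts_verts, SimpleGraph.Subgraph.verts_top,
      Set.compl_eq_univ_sdiff]
  rw [matchingSum_eq_edgeMatchingSum, hv]
  unfold edgeMatchingSum
  congr 1
  refine Finset.filter_congr fun P _ ↦ ⟨fun h ↦ ⟨fun e he ↦ ?_, h.2, h.3⟩,
    fun h ↦ ⟨fun e he ↦ ?_, h.2, h.3⟩⟩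
  · exact SimpleGraph.Subgraph.edgeSet_subset _ (h.1 e he)
  · have h1 := h.1 e he
    have h2 := h.2 e he
    induction e with
    | _ u v =>
      rw [SimpleGraph.Subgraph.mem_edgeSet, SimpleGraph.Subgraph.deleteVerts_adj]
      exact ⟨trivial, h2 u (Sym2.mem_mk_left _ _), trivial, h2 v (Sym2.mem_mk_right _ _), h1⟩

theorem matchingSum_deleteEdges [Fintype V] [CommRing R] {G : SimpleGraph V} (ω : Sym2 V → R)
    (s : Set (Sym2 V)) :
    matchingSum ω ((⊤ : G.Subgraph).deleteEdges s) =
      edgeMatchingSum ω (G.edgeSet \ s) Set.univ := by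
  have he : ((⊤ : G.Subgraph).deleteEdges s).edgeSet = G.edgeSet \ s := by
    ext e
    induction e with
    | _ u v =>
      rw [SimpleGraph.Subgraph.mem_edgeSet, SimpleGraph.Subgraph.deleteEdges_adj]
      rfl
  rw [matchingSum_eq_edgeMatchingSum, he, SimpleGraph.Subgraph.deleteEdges_verts,
    SimpleGraph.Subgraph.verts_top]

end MatchingSums

theorem corollary3p3 {V R : Type*} [Fintype V] [CommRing R]
    (G : SimpleGraph V) (D : PlaneDrawing G) (ω : Sym2 V → R)
    (hV : Even (Fintype.card V))
    (a₁ b₁ a₂ b₂ : V) (h₁ : G.Adj a₁ b₁) (h₂ : G.Adj a₂ b₂)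
    (hind : Disjoint ({a₁, b₁} : Set V) {a₂, b₂})
    (f : Set ℂ) (hf : D.IsFace f)
    (hf₁ : D.EdgeOnBoundary f h₁) (hf₂ : D.EdgeOnBoundary f h₂)
    (g : Set ℂ) (hg : D.IsFace g) (hcyc : D.InCyclicOrderOn g ![a₁, b₁, a₂, b₂]) :
    matchingSum ω (⊤ : G.Subgraph) *
          matchingSum ω ((⊤ : G.Subgraph).deleteEdges {s(a₁, b₁), s(a₂, b₂)}) +
        ω s(a₁, b₁) * ω s(a₂, b₂) *
          (matchingSum ω ((⊤ : G.Subgraph).deleteVerts {a₁, a₂}) *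
            matchingSum ω ((⊤ : G.Subgraph).deleteVerts {b₁, b₂})) =
      matchingSum ω ((⊤ : G.Subgraph).deleteEdges {s(a₁, b₁)}) *
          matchingSum ω ((⊤ : G.Subgraph).deleteEdges {s(a₂, b₂)}) +
        ω s(a₁, b₁) * ω s(a₂, b₂) *
          (matchingSum ω ((⊤ : G.Subgraph).deleteVerts {a₁, b₂}) *
            matchingSum ω ((⊤ : G.Subgraph).deleteVerts {a₂, b₁})) := by
  have hne : a₁ ≠ a₂ ∧ a₁ ≠ b₂ ∧ b₁ ≠ a₂ ∧ b₁ ≠ b₂ := by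
    simp only [Set.disjoint_left, Set.mem_insert_iff, Set.mem_singleton_iff] at hind
    exact ⟨fun h ↦ hind (Or.inl rfl) (Or.inl h), fun h ↦ hind (Or.inl rfl) (Or.inr h),
      fun h ↦ hind (Or.inr rfl) (Or.inl h), fun h ↦ hind (Or.inr rfl) (Or.inr h)⟩
  obtain ⟨haa, hab, hba, hbb⟩ := hne
  have hee : s(a₂, b₂) ≠ s(a₁, b₁) := by
    rw [Ne, Sym2.eq_iff]
    rintro (⟨h, -⟩ | ⟨h, -⟩)
    · exact haa h.symm
    · exact hba h.symm
  have hE₁ : s(a₁, b₁) ∈ G.edgeSet := h₁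
  have hE₂ : s(a₂, b₂) ∈ G.edgeSet := h₂
  set E : Set (Sym2 V) := (G.edgeSet \ {s(a₁, b₁)}) \ {s(a₂, b₂)} with hE
  have hE' : (G.edgeSet \ {s(a₂, b₂)}) \ {s(a₁, b₁)} = E := by
    rw [hE, Set.sdiff_sdiff_comm]
  -- Each vertex deletion in the statement removes one end of each of the two edges, so neither can
  -- be used.
  have hdel : ∀ {x y : V} {U : Set V}, (a₁ = x ∨ b₁ = x) → (a₂ = y ∨ b₂ = y) → x ∉ U → y ∉ U →
      edgeMatchingSum ω G.edgeSet U = edgeMatchingSum ω E U := by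
    intro x y U hx hy hxU hyU
    have e₁ : edgeMatchingSum ω (G.edgeSet \ {s(a₁, b₁)}) U = edgeMatchingSum ω G.edgeSet U := by
      rcases hx with rfl | rfl
      · exact edgeMatchingSum_diff_singleton ω _ U hxU
      · rw [Sym2.eq_swap]
        exact edgeMatchingSum_diff_singleton ω _ U hxU
    have e₂ : edgeMatchingSum ω E U = edgeMatchingSum ω (G.edgeSet \ {s(a₁, b₁)}) U := by
      rw [hE]
      rcases hy with rfl | rfl
      · exact edgeMatchingSum_diff_singleton ω _ U hyU
      · rw [Sym2.eq_swap (a := a₂)]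
        exact edgeMatchingSum_diff_singleton ω _ U hyU
    rw [e₂, e₁]
  have kuo := edgeMatchingSum_condensation ω (E := E)
    (fun e he ↦ he.1.1) h₁.ne haa hab hba hbb h₂.ne
    (fun K hK ↦ D.reachable_of_inCyclicOrderOn hg hcyc hK)
  have top : matchingSum ω (⊤ : G.Subgraph) = edgeMatchingSum ω G.edgeSet Set.univ := by
    rw [matchingSum_eq_edgeMatchingSum, SimpleGraph.Subgraph.edgeSet_top,
      SimpleGraph.Subgraph.verts_top]
  have del : G.edgeSet \ {s(a₁, b₁), s(a₂, b₂)} = E := by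
    rw [hE, Set.sdiff_sdiff, Set.singleton_union]
  have mem : ∀ v ∈ ({a₂, b₂} : Set V), v ∈ Set.univ \ ({a₁, b₁} : Set V) :=
    fun v hv ↦ ⟨trivial, fun h ↦ Set.disjoint_left.1 hind h hv⟩
  have x0 := edgeMatchingSum_eq_add ω G.edgeSet Set.univ hE₁ (Set.mem_univ _) (Set.mem_univ _)
  have x1 := edgeMatchingSum_eq_add ω (G.edgeSet \ {s(a₁, b₁)}) Set.univ (a := a₂) (b := b₂)
    ⟨hE₂, hee⟩ (Set.mem_univ _) (Set.mem_univ _)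
  have x2 := edgeMatchingSum_eq_add ω (G.edgeSet \ {s(a₂, b₂)}) Set.univ (a := a₁) (b := b₁)
    ⟨hE₁, hee.symm⟩ (Set.mem_univ _) (Set.mem_univ _)
  have x3 := edgeMatchingSum_eq_add ω (G.edgeSet \ {s(a₁, b₁)}) (Set.univ \ {a₁, b₁})
    (a := a₂) (b := b₂) ⟨hE₂, hee⟩ (mem _ (by simp)) (mem _ (by simp))
  have hu : ((Set.univ : Set V) \ {a₁, b₁}) \ {a₂, b₂} = ({a₁, b₁, a₂, b₂}ᶜ : Set V) := by
    rw [Set.sdiff_sdiff, ← Set.compl_eq_univ_sdiff, Set.insert_union, Set.singleton_union]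
  rw [hu] at x3
  rw [hE'] at x2
  rw [← hE] at x1 x3
  rw [← Set.compl_eq_univ_sdiff] at x0 x1 x2 x3
  rw [matchingSum_deleteEdges, matchingSum_deleteEdges, matchingSum_deleteEdges,
    matchingSum_deleteVerts, matchingSum_deleteVerts, matchingSum_deleteVerts,
    matchingSum_deleteVerts, top, del,
    hdel (Or.inl rfl) (Or.inl rfl) (U := {a₁, a₂}ᶜ) (by simp) (by simp),
    hdel (Or.inr rfl) (Or.inr rfl) (U := {b₁, b₂}ᶜ) (by simp) (by simp),
    hdel (Or.inl rfl) (Or.inr rfl) (U := {a₁, b₂}ᶜ) (by simp) (by simp),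
    hdel (Or.inr rfl) (Or.inl rfl) (U := {a₂, b₁}ᶜ) (by simp) (by simp),
    x0, x1, x2, x3, Set.pair_comm a₂ b₁]
  -- After expansion the terms of degree at most one in the two displayed weights cancel, as do
  -- those with a squared weight.
  linear_combination ω s(a₁, b₁) * ω s(a₂, b₂) * kuo
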